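/- For $a,b>0$ let $T(a,b)=(\mathbb{R}/a\mathbb{Z})\times(\mathbb{R}/b\mathbb{Z})$ be the flat torus. A $k$-partition of $T(a,b)$ is a family $\mathcal{D}=(D_i)_{1\le i\le k}$ of nonempty, open, connected and mutually disjoint subsets; its energy is $\Lambda_k(\mathcal{D})=\max_{1\le i\le k}\lambda_1(D_i)$, where $\lambda_1(\omega)$ is the first eigenvalue of the Dirichlet Laplacian (that is, of the Friedrichs extension of $-\Delta$ acting on $C_c^\infty(\omega)$) on the open set $\omega$. Let $b>0$ and let $\Pi_2:T(2,b)\to T(1,b)$, $(x,y)\mapsto(x \bmod 1,\,y)$, be the two-sheeted covering, and $\sigma:T(2,b)\to T(2,b)$, $\sigma(x,y)=(x+1 \bmod 2,\,y)$. For a $k$-partition $\mathcal{D}=(D_i)_{1\le i\le k}$ of $T(1,b)$, the lifted partition $\Pi_2^{-1}(\mathcal{D})$ is the family of all the connected components of all the sets $\Pi_2^{-1}(D_i)$, $1\le i\le k$. Let $(\lambda_j^{\sigma,a})_{j\ge1}$ be the eigenvalues, arranged in non-decreasing order and counted with multiplicities, of the Friedrichs extension of $-\Delta$ acting on the functions $u\in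 C^\infty(T(2,b))$ that are antisymmetric, i.e. $u\circ\sigma=-u$. **Proposition.** Let $k\ge1$ and let $\mathcal{D}$ be a $k$-partition of $T(1,b)$ such that $\Pi_2^{-1}(\mathcal{D})$ is a $2k$-partition of $T(2,b)$ (i.e. has exactly $2k$ domains). Then $$\lambda_k^{\sigma,a}\;\le\;\Lambda_{2k}\bigl(\Pi_2^{-1}(\mathcal{D})\bigr)=\Lambda_k(\mathcal{D}).$$ -/

import Mathlib

open MeasureTheory

noncomputable section

namespace TorusPartition

/-- The flat torus `(ℝ / aℤ) × (ℝ / bℤ)`, with its quotient topology; its `volume` is the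
flat area, of total mass `a * b`. -/
abbrev Torus (a b : ℝ) : Type := AddCircle a × AddCircle b

/-- A `k`-partition of a space: a family of `k` open, connected (in particular non-empty) and
mutually disjoint subsets. -/
structure IsPartition {X : Type*} [TopologicalSpace X] {k : ℕ} (D : Fin k → Set X) : Prop where
  isOpen : ∀ i, IsOpen (D i)
  isConnected : ∀ i, IsConnected (D i)
  disjoint : ∀ i j, i ≠ j → Disjoint (D i) (D j)

instance fact_zero_lt_two_real : Fact ((0 : ℝ) < 2) := ⟨two_pos⟩

section Laplacian

variable {a b : ℝ}

/-- `φ` is a smooth function on the torus: its doubly periodic lift to the plane is smooth. -/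
def IsSmooth (φ : Torus a b → ℝ) : Prop :=
  ContDiff ℝ ((⊤ : ℕ∞) : WithTop ℕ∞)
    (fun p : ℝ × ℝ => φ ((p.1 : AddCircle a), (p.2 : AddCircle b)))

/-- The partial derivative in the first variable. -/
def dx (φ : Torus a b → ℝ) (z : Torus a b) : ℝ :=
  deriv (fun t : ℝ => φ (z.1 + (t : AddCircle a), z.2)) 0

/-- The partial derivative in the second variable. -/
def dy (φ : Torus a b → ℝ) (z : Torus a b) : ℝ :=
  deriv (fun t : ℝ => φ (z.1, z.2 + (t : AddCircle b))) 0

variable [Fact (0 < a)] [Fact (0 < b)]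

/-- The real Hilbert space `L²` of the torus. -/
abbrev L2 (a b : ℝ) [Fact (0 < a)] [Fact (0 < b)] : Type :=
  Lp ℝ 2 (volume : Measure (Torus a b))

/-- The classes in `L²` of the functions of `C`. -/
def classes (C : Set (Torus a b → ℝ)) : Set (L2 a b) :=
  {u | ∃ φ ∈ C, u =ᵐ[volume] φ}

/-- The triples `(φ, ∂φ/∂x, ∂φ/∂y)` in `L² × L² × L²`, for `φ` in `C`. -/
def gradientGraph (C : Set (Torus a b → ℝ)) : Set (L2 a b × L2 a b × L2 a b) :=
  {w | ∃ φ ∈ C, w.1 =ᵐ[volume] φ ∧ w.2.1 =ᵐ[volume] dx φ ∧ w.2.2 =ᵐ[volume] dy φ}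

/-- The completion in the `H¹` norm of a space `C` of smooth functions. Each of its elements is
written as `(u, ∂u/∂x, ∂u/∂y)`, with the derivatives in the weak sense; convergence in
`L² × L² × L²` of these triples is convergence in `H¹`. -/
def formDomain (C : Set (Torus a b → ℝ)) : Set (L2 a b × L2 a b × L2 a b) :=
  closure (gradientGraph C)

/-- `u` is in the domain of the Friedrichs extension `H` of the operator `-Δ` acting on the
space `C` of smooth functions (an operator in the Hilbert space `closure (classes C)`), and
`H u = f`: this means that `u` is in the form domain and that
`∫ ∇u · ∇v = ∫ f v` for every `v` in the form domain. -/
def IsFriedrichsLaplacian (C : Set (Torus a b → ℝ)) (u f : L2 a b) : Prop :=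
  f ∈ closure (classes C) ∧
    ∃ p q : L2 a b, (u, p, q) ∈ formDomain C ∧
      ∀ v r s : L2 a b, (v, r, s) ∈ formDomain C →
        inner ℝ p r + inner ℝ q s = inner ℝ f v

/-- `u` is an eigenfunction, for the eigenvalue `μ`, of the Friedrichs extension of `-Δ`
acting on `C`. -/
def IsEigenfunction (C : Set (Torus a b → ℝ)) (μ : ℝ) (u : L2 a b) : Prop :=
  u ≠ 0 ∧ IsFriedrichsLaplacian C u (μ • u)

/-- The `j`-th eigenvalue (`j ≥ 1`) of the Friedrichs extension of `-Δ` acting on `C`, the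
eigenvalues being arranged in non-decreasing order and counted with multiplicities: the least
`t` such that at least `j` eigenvalues, counted with multiplicities, are at most `t`. -/
def eigenvalue (C : Set (Torus a b → ℝ)) (j : ℕ) : ℝ :=
  sInf {t : ℝ | ∃ u : Fin j → L2 a b, LinearIndependent ℝ u ∧
    ∀ i, ∃ μ ≤ t, IsEigenfunction C μ (u i)}

/-- The smooth functions with compact support in `ω` (the torus being compact, every closed
subset of it is compact). The Friedrichs extension of `-Δ` acting on them is the Dirichlet
Laplacian of `ω`, with form domain `H¹₀(ω)`. -/
def testFunctions (ω : Set (Torus a b)) : Set (Torus a b → ℝ) :=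
  {φ | IsSmooth φ ∧ tsupport φ ⊆ ω}

/-- The `j`-th eigenvalue of the Dirichlet Laplacian on the open set `ω`. -/
def dirichletEigenvalue (ω : Set (Torus a b)) (j : ℕ) : ℝ :=
  eigenvalue (testFunctions ω) j

/-- The energy of a `k`-partition (`k ≥ 1`): the largest of the first Dirichlet eigenvalues of
its domains. -/
def energy {k : ℕ} (D : Fin k → Set (Torus a b)) : ℝ :=
  ⨆ i, dirichletEigenvalue (D i) 1

end Laplacian

section DoubleCover

/-- The map `ℝ / 2ℤ → ℝ / ℤ`, `x ↦ x mod 1`. -/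
def mod1 : AddCircle (2 : ℝ) →+ AddCircle (1 : ℝ) :=
  QuotientAddGroup.map (AddSubgroup.zmultiples (2 : ℝ)) (AddSubgroup.zmultiples (1 : ℝ))
    (AddMonoidHom.id ℝ) (by
      rw [AddSubgroup.zmultiples_le]
      exact ⟨2, by norm_num⟩)

variable (b : ℝ)

/-- The two-sheeted covering `(x, y) ↦ (x mod 1, y)`. -/
def cover (z : Torus 2 b) : Torus 1 b := (mod1 z.1, z.2)

/-- The deck transformation `σ : (x, y) ↦ (x + 1 mod 2, y)` of the two-sheeted covering. -/
def sigma (z : Torus 2 b) : Torus 2 b := (z.1 + ((1 : ℝ) : AddCircle (2 : ℝ)), z.2)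

/-- The domains of the partition lifted from `D`: all the connected components of all the
preimages of the domains of `D` under the covering. -/
def liftedDomains {k : ℕ} (D : Fin k → Set (Torus 1 b)) : Set (Set (Torus 2 b)) :=
  {C | ∃ i, ∃ z ∈ cover b ⁻¹' D i, C = connectedComponentIn (cover b ⁻¹' D i) z}

/-- The smooth antisymmetric functions on the double cover. -/
def antisymmetricFunctions : Set (Torus 2 b → ℝ) :=
  {φ | IsSmooth φ ∧ ∀ z, φ (sigma b z) = -φ z}

/-- The `k`-th antisymmetric eigenvalue: the `k`-th eigenvalue of the Friedrichs extension of
`-Δ` acting on the smooth antisymmetric functions. -/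
def antisymmetricEigenvalue [Fact (0 < b)] (k : ℕ) : ℝ :=
  eigenvalue (antisymmetricFunctions b) k

end DoubleCover

end TorusPartition

end

noncomputable section

namespace TorusPartition

-- Spectral counting for compact symmetric operators, and a compactness criterion.

section CompactOperators

open Module.End

variable {V : Type*} [NormedAddCommGroup V] [InnerProductSpace ℝ V]

-- The preimage of a connected `D i` is the union of one component `C` and its translate by `sigma`,
-- so it has at most two components. Since there are `2 * k` lifted domains, each preimage has
-- exactly two, and the covering identifies each of them with `D i`
-- (`isSheet_of_range_eq_liftedDomains`). A test function on `D i` can thus be moved to one sheet,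
-- and back by summing over the two sheets, with the same mass and Dirichlet energy. Hence first
-- Dirichlet eigenvalues agree (`dirichletEigenvalue_eq_of_isSheet`), and so do the energies of the
-- partitions.
--
-- For the inequality, take for each `i` an almost optimal test function on `D i`, put it on one
-- sheet and subtract its translate by `sigma`. This gives `k` antisymmetric functions with disjoint
-- supports and Rayleigh quotients below any prescribed `t > energy D`; min-max then bounds the
-- `k`-th antisymmetric eigenvalue (`antisymmetricEigenvalue_le_energy`).
--
-- Eigenvalues are defined by counting eigenfunctions, so min-max has to be proved. On the form
-- domain with the H¹ inner product, let `J` be the map to L². It is compact, by Parseval on the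
-- torus (`exists_norm_sq_toL2_le`), and an eigenvalue `κ > 0` of `J† J` corresponds to the
-- eigenvalue `1 / κ - 1` of the Laplacian. A subspace with small Rayleigh quotients therefore
-- produces enough eigenfunctions (`mem_spectralBounds_of_disjoint`). Conversely, a first
-- eigenfunction is a limit of smooth functions, which gives almost optimal test functions
-- (`exists_gradSq_lt`).

theorem inner_map_self_le_of_mem_iSup_eigenspace {K : V →ₗ[ℝ] V} (hs : K.IsSymmetric) {c : ℝ}
    {x : V} (hx : x ∈ ⨆ κ : {κ : ℝ // κ < c}, eigenspace K (κ : ℝ)) :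
    inner ℝ (K x) x ≤ c * ‖x‖ ^ 2 := by
  classical
  obtain ⟨f, hf, rfl⟩ := (Submodule.mem_iSup_iff_exists_finsupp _ _).1 hx
  have horth : ∀ i j : {κ : ℝ // κ < c}, i ≠ j → inner ℝ (f i) (f j) = 0 := by
    intro i j hij
    have := hs.orthogonalFamily_eigenspaces (fun h => hij (Subtype.ext h))
      ⟨f i, hf i⟩ ⟨f j, hf j⟩
    simpa using this
  have hK : ∀ i, K (f i) = (i : ℝ) • f i := fun i => mem_eigenspace_iff.1 (hf i)
  have key : ∀ g : {κ : ℝ // κ < c} → ℝ,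
      inner ℝ (∑ i ∈ f.support, g i • f i) (∑ i ∈ f.support, f i)
        = ∑ i ∈ f.support, g i * ‖f i‖ ^ 2 := by
    intro g
    rw [sum_inner]
    refine Finset.sum_congr rfl fun i hi => ?_
    rw [inner_sum, Finset.sum_eq_single i]
    · rw [real_inner_smul_left, real_inner_self_eq_norm_sq]
    · intro j _ hj
      rw [real_inner_smul_left, horth i j (Ne.symm hj), mul_zero]
    · exact fun h => absurd hi h
  have e1 := key (fun i => (i : ℝ))
  have e2 := key (fun _ => 1)
  simp only [one_smul, one_mul, real_inner_self_eq_norm_sq] at e2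
  rw [Finsupp.sum, map_sum]
  simp only [hK]
  rw [e1, e2, Finset.mul_sum]
  exact Finset.sum_le_sum fun i _ => mul_le_mul_of_nonneg_right i.2.le (sq_nonneg _)

/-- If the eigenvectors for eigenvalues at least `c'` spanned fewer than `k` dimensions, some
nonzero `x` in the span of `w` would be orthogonal to all of them, and the spectral theorem would
bound its Rayleigh quotient by `c'`. Passing to the closure keeps only a weak inequality, hence the
gap `c' < c`. -/
theorem exists_eigenvectors_of_rayleigh_ge [CompleteSpace V] (K : V →L[ℝ] V)
    (hK : IsCompactOperator K) (hs : (K : V →ₗ[ℝ] V).IsSymmetric) {c c' : ℝ} (hc : c' < c) {k : ℕ}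
    {w : Fin k → V} (hw : LinearIndependent ℝ w)
    (h : ∀ x ∈ Submodule.span ℝ (Set.range w), c * ‖x‖ ^ 2 ≤ inner ℝ (K x) x) :
    ∃ v : Fin k → V, LinearIndependent ℝ v ∧ ∀ i, ∃ κ, c' ≤ κ ∧ K (v i) = κ • v i := by
  classical
  set G : Set V := {v | ∃ κ, c' ≤ κ ∧ K v = κ • v} with hG
  obtain ⟨B, hBG, hBspan, hB⟩ := exists_linearIndependent ℝ G
  by_cases hcard : (k : Cardinal) ≤ Cardinal.mk B
  · obtain ⟨e⟩ : Nonempty (Fin k ↪ B) := by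
      rw [← Cardinal.lift_mk_le']
      simpa using hcard
    exact ⟨fun i => e i, hB.comp e e.injective, fun i => hBG (e i).2⟩
  exfalso
  rw [not_le] at hcard
  have hfin : Finite B := by
    rw [← Cardinal.lt_aleph0_iff_finite]
    exact hcard.trans (Cardinal.natCast_lt_aleph0 (n := k))
  have := Fintype.ofFinite B
  set S := Submodule.span ℝ B with hS
  have hSfin : FiniteDimensional ℝ S := FiniteDimensional.span_of_finite ℝ hfin
  have hSrank : Module.finrank ℝ S < k := by
    have h1 : Module.finrank ℝ S = Fintype.card B := by
      have := finrank_span_eq_card hB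
      rwa [Subtype.range_coe] at this
    rw [h1]
    simpa using hcard
  set W := Submodule.span ℝ (Set.range w) with hW
  have hWrank : Module.finrank ℝ W = k := by simpa using finrank_span_eq_card hw
  have hWfin : FiniteDimensional ℝ W := FiniteDimensional.span_of_finite ℝ (Set.finite_range w)
  obtain ⟨x, hx, hx0⟩ : ∃ x ∈ LinearMap.ker ((S.orthogonalProjectionOnto : V →ₗ[ℝ] S).comp W.subtype),
      x ≠ 0 := by
    apply Submodule.exists_mem_ne_zero_of_ne_bot
    apply LinearMap.ker_ne_bot_of_finrank_lt
    rw [hWrank]; exact hSrank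
  have hxS : (x : V) ∈ Sᗮ := by
    have : S.orthogonalProjectionOnto (x : V) = 0 := hx
    exact (Submodule.orthogonalProjectionOnto_eq_zero_iff).1 this
  set A : Submodule ℝ V := ⨆ κ : {κ : ℝ // κ < c'}, eigenspace (K : V →ₗ[ℝ] V) (κ : ℝ) with hA
  have hAS : A ≤ Sᗮ := by
    refine iSup_le fun κ y hy => ?_
    rw [hBspan, Submodule.mem_orthogonal]
    intro u hu
    induction hu using Submodule.span_induction with
    | mem u hu =>
      obtain ⟨ν, hν, hu⟩ := hu
      have := hs.orthogonalFamily_eigenspaces (i := ν) (j := κ)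
        (fun h => absurd κ.2 (by rw [← h]; exact not_lt.2 hν))
        ⟨u, mem_eigenspace_iff.2 hu⟩ ⟨y, hy⟩
      simpa using this
    | zero => simp
    | add a b _ _ ha hb => rw [inner_add_left, ha, hb, add_zero]
    | smul t a _ ha => rw [real_inner_smul_left, ha, mul_zero]
  -- Every eigenspace lies in `S` or in `A`, according to its eigenvalue, and the eigenspaces of a
  -- compact symmetric operator have trivial common orthogonal.
  have htop : Sᗮ ⊓ Aᗮ = ⊥ := by
    rw [eq_bot_iff, ← ContinuousLinearMap.orthogonalComplement_iSup_eigenspaces_eq_bot hK hs,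
      Submodule.inf_orthogonal]
    apply Submodule.orthogonal_le
    refine iSup_le fun κ => ?_
    rcases lt_or_ge κ c' with hκ | hκ
    · exact le_sup_of_le_right (le_iSup (fun κ : {κ : ℝ // κ < c'} =>
        eigenspace (K : V →ₗ[ℝ] V) (κ : ℝ)) ⟨κ, hκ⟩)
    · refine le_sup_of_le_left fun y hy => ?_
      rw [hBspan]
      exact Submodule.subset_span ⟨κ, hκ, mem_eigenspace_iff.1 hy⟩
  have hxA : (x : V) ∈ A.topologicalClosure := by
    rw [← Submodule.orthogonal_orthogonal_eq_closure]
    have : CompleteSpace A.topologicalClosure :=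
      A.isClosed_topologicalClosure.completeSpace_coe
    obtain ⟨y, hy, z, hz, hyz⟩ :=
      Submodule.exists_add_mem_mem_orthogonal (K := A.topologicalClosure) (x : V)
    have hyS : y ∈ Sᗮ :=
      Submodule.topologicalClosure_minimal _ hAS (Submodule.isClosed_orthogonal S) hy
    have hzA : z ∈ Aᗮ := Submodule.orthogonal_le A.le_topologicalClosure hz
    have hzS : z ∈ Sᗮ := by
      have : z = x - y := by rw [hyz]; abel
      rw [this]; exact Submodule.sub_mem _ hxS hyS
    have hz0 : z ∈ (⊥ : Submodule ℝ V) := htop ▸ ⟨hzS, hzA⟩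
    rw [Submodule.mem_bot] at hz0
    rw [hyz, hz0, add_zero, Submodule.orthogonal_orthogonal_eq_closure]
    exact hy
  have hle : inner ℝ (K (x : V)) (x : V) ≤ c' * ‖(x : V)‖ ^ 2 := by
    have hcl : IsClosed {y : V | inner ℝ (K y) y ≤ c' * ‖y‖ ^ 2} :=
      isClosed_le (by fun_prop) (by fun_prop)
    exact closure_minimal (fun y hy => inner_map_self_le_of_mem_iSup_eigenspace hs hy) hcl hxA
  have hpos : 0 < ‖(x : V)‖ ^ 2 := by
    have : (x : V) ≠ 0 := by simpa using hx0
    positivity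
  have := h x x.2
  nlinarith

/-- A bounded operator is compact when its norm is controlled, up to an arbitrarily small multiple
of the norm of the argument, by finitely many continuous linear functionals. -/
theorem isCompactOperator_of_norm_sq_le [CompleteSpace V] {H : Type*} [NormedAddCommGroup H]
    [InnerProductSpace ℝ H] [CompleteSpace H] (J : V →L[ℝ] H)
    (h : ∀ ε > 0, ∃ (ι : Type) (_ : Fintype ι) (g : ι → H), ∀ v,
      ‖J v‖ ^ 2 ≤ ε * ‖v‖ ^ 2 + ∑ i, (inner ℝ (g i) (J v)) ^ 2) :
    IsCompactOperator J := by
  have hclosed := isClosed_setOfPred_isCompactOperator (σ₁₂ := RingHom.id ℝ) (M₁ := V) (M₂ := H)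
  -- `J` is a norm limit of finite-rank operators: compose it with the projection onto the
  -- orthogonal of the common kernel `M` of the functionals. The error lives on `M`, where only the
  -- `ε` term survives.
  refine hclosed.closure_subset (Metric.mem_closure_iff.2 fun ε hε => ?_)
  obtain ⟨ι, _, g, hg⟩ := h ((ε / 2) ^ 2) (by positivity)
  let F : V →L[ℝ] (ι → ℝ) := ContinuousLinearMap.pi fun i => (innerSL ℝ (g i)).comp J
  let M : Submodule ℝ V := LinearMap.ker (F : V →ₗ[ℝ] (ι → ℝ))
  have hMc : IsClosed (M : Set V) := F.isClosed_ker
  have : CompleteSpace M := hMc.completeSpace_coe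
  have hfd : FiniteDimensional ℝ Mᗮ := by
    refine FiniteDimensional.of_injective ((F : V →ₗ[ℝ] (ι → ℝ)).comp Mᗮ.subtype) ?_
    rw [← LinearMap.ker_eq_bot, LinearMap.ker_eq_bot']
    intro x hx
    have hxM : (x : V) ∈ M := hx
    have : inner ℝ (x : V) (x : V) = 0 := Submodule.inner_right_of_mem_orthogonal hxM x.2
    exact Subtype.ext (inner_self_eq_zero.1 this)
  have hloc : ProperSpace Mᗮ := FiniteDimensional.proper ℝ Mᗮ
  refine ⟨(J.comp Mᗮ.subtypeL).comp Mᗮ.orthogonalProjectionOnto, ?_, ?_⟩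
  · have h1 : IsCompactOperator (id : Mᗮ → Mᗮ) := isCompactOperator_id
    exact (h1.clm_comp (J.comp Mᗮ.subtypeL)).comp_clm Mᗮ.orthogonalProjectionOnto
  · rw [dist_eq_norm]
    refine lt_of_le_of_lt (ContinuousLinearMap.opNorm_le_bound _ (half_pos hε).le fun v => ?_)
      (half_lt_self hε)
    have hv : (J - (J.comp Mᗮ.subtypeL).comp Mᗮ.orthogonalProjectionOnto) v
        = J (M.orthogonalProjectionOnto v) := by
      have := M.starProjection_add_starProjection_orthogonal v
      simp only [sub_apply, ContinuousLinearMap.comp_apply,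
        Submodule.subtypeL_apply]
      rw [← map_sub]
      congr 1
      rw [sub_eq_iff_eq_add]
      exact this.symm
    rw [hv]
    have h0 : ∀ i, inner ℝ (g i) (J (M.orthogonalProjectionOnto v : V)) = 0 := fun i => by
      have : F (M.orthogonalProjectionOnto v : V) = 0 := (M.orthogonalProjectionOnto v).2
      exact congrFun this i
    have h1 := hg (M.orthogonalProjectionOnto v : V)
    simp only [h0] at h1
    have h2 : ‖(M.orthogonalProjectionOnto v : V)‖ ≤ ‖v‖ := M.norm_orthogonalProjectionOnto_apply_le v
    have h3 : ‖J (M.orthogonalProjectionOnto v : V)‖ ^ 2 ≤ (ε / 2 * ‖v‖) ^ 2 := by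
      have : ‖(M.orthogonalProjectionOnto v : V)‖ ^ 2 ≤ ‖v‖ ^ 2 := by gcongr
      have : (ε / 2) ^ 2 * ‖(M.orthogonalProjectionOnto v : V)‖ ^ 2 ≤ (ε / 2) ^ 2 * ‖v‖ ^ 2 := by
        gcongr
      simp only [ne_eq, OfNat.ofNat_ne_zero, not_false_eq_true, zero_pow,
        Finset.sum_const_zero, add_zero] at h1
      nlinarith
    exact abs_le_of_sq_le_sq' h3 (by positivity) |>.2

end CompactOperators

-- Smooth functions on the torus and their gradient triples.

section SmoothFunctions

variable {a b : ℝ}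

/-- The projection of the plane onto the torus. -/
def torusMk (a b : ℝ) (p : ℝ × ℝ) : Torus a b := ((p.1 : AddCircle a), (p.2 : AddCircle b))

theorem torusMk_surjective : Function.Surjective (torusMk a b) := by
  rintro ⟨x, y⟩
  obtain ⟨x, rfl⟩ := QuotientAddGroup.mk_surjective x
  obtain ⟨y, rfl⟩ := QuotientAddGroup.mk_surjective y
  exact ⟨(x, y), rfl⟩

theorem isOpenQuotientMap_torusMk : IsOpenQuotientMap (torusMk a b) :=
  QuotientAddGroup.isOpenQuotientMap_mk.prodMap QuotientAddGroup.isOpenQuotientMap_mk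

theorem continuous_torusMk : Continuous (torusMk a b) := isOpenQuotientMap_torusMk.continuous

theorem isSmooth_iff {φ : Torus a b → ℝ} :
    IsSmooth φ ↔ ContDiff ℝ ((⊤ : ℕ∞) : WithTop ℕ∞) (φ ∘ torusMk a b) := Iff.rfl

theorem IsSmooth.differentiable {φ : Torus a b → ℝ} (h : IsSmooth φ) :
    Differentiable ℝ (φ ∘ torusMk a b) :=
  (isSmooth_iff.1 h).differentiable (by simp)

theorem IsSmooth.continuous {φ : Torus a b → ℝ} (h : IsSmooth φ) : Continuous φ :=
  isOpenQuotientMap_torusMk.isQuotientMap.continuous_iff.2 (ContDiff.continuous h)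

theorem IsSmooth.add {φ ψ : Torus a b → ℝ} (hφ : IsSmooth φ) (hψ : IsSmooth ψ) :
    IsSmooth (φ + ψ) := ContDiff.add hφ hψ

theorem IsSmooth.smul {φ : Torus a b → ℝ} (c : ℝ) (hφ : IsSmooth φ) : IsSmooth (c • φ) :=
  ContDiff.const_smul c hφ

theorem isSmooth_zero : IsSmooth (0 : Torus a b → ℝ) := contDiff_const

theorem dx_torusMk (φ : Torus a b → ℝ) (p : ℝ × ℝ) :
    dx φ (torusMk a b p) = deriv (fun t => (φ ∘ torusMk a b) (p.1 + t, p.2)) 0 := rfl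

theorem dy_torusMk (φ : Torus a b → ℝ) (p : ℝ × ℝ) :
    dy φ (torusMk a b p) = deriv (fun t => (φ ∘ torusMk a b) (p.1, p.2 + t)) 0 := rfl

theorem IsSmooth.hasDerivAt_fst {φ : Torus a b → ℝ} (h : IsSmooth φ) (x y : ℝ) :
    HasDerivAt (fun t => φ (torusMk a b (t, y))) (dx φ (torusMk a b (x, y))) x := by
  have hd : DifferentiableAt ℝ (fun t => φ (torusMk a b (t, y))) x :=
    DifferentiableAt.comp (g := φ ∘ torusMk a b) (f := fun t : ℝ => (t, y)) x
      (h.differentiable (x, y)) (by fun_prop)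
  have : dx φ (torusMk a b (x, y)) = deriv (fun t => φ (torusMk a b (t, y))) x := by
    rw [dx_torusMk]
    simpa using deriv_comp_const_add (fun t => φ (torusMk a b (t, y))) x 0
  rw [this]
  exact hd.hasDerivAt

theorem IsSmooth.hasDerivAt_snd {φ : Torus a b → ℝ} (h : IsSmooth φ) (x y : ℝ) :
    HasDerivAt (fun t => φ (torusMk a b (x, t))) (dy φ (torusMk a b (x, y))) y := by
  have hd : DifferentiableAt ℝ (fun t => φ (torusMk a b (x, t))) y :=
    DifferentiableAt.comp (g := φ ∘ torusMk a b) (f := fun t : ℝ => (x, t)) y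
      (h.differentiable (x, y)) (by fun_prop)
  have : dy φ (torusMk a b (x, y)) = deriv (fun t => φ (torusMk a b (x, t))) y := by
    rw [dy_torusMk]
    simpa using deriv_comp_const_add (fun t => φ (torusMk a b (x, t))) y 0
  rw [this]
  exact hd.hasDerivAt

/-- The Fréchet derivative of the lift is jointly smooth in the base point; this is how `dx φ`
inherits smoothness. -/
theorem IsSmooth.dx_torusMk_eq_fderiv {φ : Torus a b → ℝ} (h : IsSmooth φ) (p : ℝ × ℝ) :
    dx φ (torusMk a b p) = fderiv ℝ (φ ∘ torusMk a b) p (1, 0) := by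
  have h2 : HasDerivAt (fun t : ℝ => (t, p.2)) ((1 : ℝ), (0 : ℝ)) p.1 :=
    (hasDerivAt_id p.1).prodMk (hasDerivAt_const p.1 p.2)
  exact (h.hasDerivAt_fst p.1 p.2).unique
    (HasFDerivAt.comp_hasDerivAt (l := φ ∘ torusMk a b) (f := fun t : ℝ => (t, p.2)) p.1
      (h.differentiable p).hasFDerivAt h2)

theorem IsSmooth.dy_torusMk_eq_fderiv {φ : Torus a b → ℝ} (h : IsSmooth φ) (p : ℝ × ℝ) :
    dy φ (torusMk a b p) = fderiv ℝ (φ ∘ torusMk a b) p (0, 1) := by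
  have h2 : HasDerivAt (fun t : ℝ => (p.1, t)) ((0 : ℝ), (1 : ℝ)) p.2 :=
    (hasDerivAt_const p.2 p.1).prodMk (hasDerivAt_id p.2)
  exact (h.hasDerivAt_snd p.1 p.2).unique
    (HasFDerivAt.comp_hasDerivAt (l := φ ∘ torusMk a b) (f := fun t : ℝ => (p.1, t)) p.2
      (h.differentiable p).hasFDerivAt h2)

theorem IsSmooth.dx {φ : Torus a b → ℝ} (h : IsSmooth φ) : IsSmooth (dx φ) := by
  rw [isSmooth_iff, show TorusPartition.dx φ ∘ torusMk a b
    = fun p => fderiv ℝ (φ ∘ torusMk a b) p (1, 0) from funext h.dx_torusMk_eq_fderiv]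
  exact ((isSmooth_iff.1 h).fderiv_right (m := ((⊤ : ℕ∞) : WithTop ℕ∞)) le_rfl).clm_apply
    contDiff_const

theorem IsSmooth.dy {φ : Torus a b → ℝ} (h : IsSmooth φ) : IsSmooth (dy φ) := by
  rw [isSmooth_iff, show TorusPartition.dy φ ∘ torusMk a b
    = fun p => fderiv ℝ (φ ∘ torusMk a b) p (0, 1) from funext h.dy_torusMk_eq_fderiv]
  exact ((isSmooth_iff.1 h).fderiv_right (m := ((⊤ : ℕ∞) : WithTop ℕ∞)) le_rfl).clm_apply
    contDiff_const

theorem dx_add {φ ψ : Torus a b → ℝ} (hφ : IsSmooth φ) (hψ : IsSmooth ψ) :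
    dx (φ + ψ) = dx φ + dx ψ := by
  funext z
  obtain ⟨⟨x, y⟩, rfl⟩ := torusMk_surjective z
  exact ((hφ.add hψ).hasDerivAt_fst x y).unique
    ((hφ.hasDerivAt_fst x y).add (hψ.hasDerivAt_fst x y))

theorem dy_add {φ ψ : Torus a b → ℝ} (hφ : IsSmooth φ) (hψ : IsSmooth ψ) :
    dy (φ + ψ) = dy φ + dy ψ := by
  funext z
  obtain ⟨⟨x, y⟩, rfl⟩ := torusMk_surjective z
  exact ((hφ.add hψ).hasDerivAt_snd x y).unique
    ((hφ.hasDerivAt_snd x y).add (hψ.hasDerivAt_snd x y))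

theorem dx_smul {φ : Torus a b → ℝ} (c : ℝ) (hφ : IsSmooth φ) : dx (c • φ) = c • dx φ := by
  funext z
  obtain ⟨⟨x, y⟩, rfl⟩ := torusMk_surjective z
  exact ((hφ.smul c).hasDerivAt_fst x y).unique ((hφ.hasDerivAt_fst x y).const_smul c)

theorem dy_smul {φ : Torus a b → ℝ} (c : ℝ) (hφ : IsSmooth φ) : dy (c • φ) = c • dy φ := by
  funext z
  obtain ⟨⟨x, y⟩, rfl⟩ := torusMk_surjective z
  exact ((hφ.smul c).hasDerivAt_snd x y).unique ((hφ.hasDerivAt_snd x y).const_smul c)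

theorem dx_zero : dx (0 : Torus a b → ℝ) = 0 := by
  funext z
  simp [dx]

theorem dy_zero : dy (0 : Torus a b → ℝ) = 0 := by
  funext z
  simp [dy]

theorem continuous_translate_fst (z : Torus a b) :
    Continuous fun t : ℝ => (z.1 + (t : AddCircle a), z.2) :=
  (continuous_const.add (AddCircle.continuous_mk' a)).prodMk continuous_const

theorem continuous_translate_snd (z : Torus a b) :
    Continuous fun t : ℝ => (z.1, z.2 + (t : AddCircle b)) :=
  continuous_const.prodMk (continuous_const.add (AddCircle.continuous_mk' b))

theorem dx_congr {φ ψ : Torus a b → ℝ} {z : Torus a b} (h : φ =ᶠ[nhds z] ψ) :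
    dx φ z = dx ψ z := by
  have hc : Filter.Tendsto (fun t : ℝ => (z.1 + (t : AddCircle a), z.2)) (nhds 0) (nhds z) := by
    simpa using (continuous_translate_fst z).tendsto 0
  exact Filter.EventuallyEq.deriv_eq (hc.eventually h)

theorem dy_congr {φ ψ : Torus a b → ℝ} {z : Torus a b} (h : φ =ᶠ[nhds z] ψ) :
    dy φ z = dy ψ z := by
  have hc : Filter.Tendsto (fun t : ℝ => (z.1, z.2 + (t : AddCircle b))) (nhds 0) (nhds z) := by
    simpa using (continuous_translate_snd z).tendsto 0
  exact Filter.EventuallyEq.deriv_eq (hc.eventually h)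

theorem dx_eq_zero_of_notMem_tsupport {φ : Torus a b → ℝ} {z : Torus a b} (h : z ∉ tsupport φ) :
    dx φ z = 0 := by
  rw [dx_congr (notMem_tsupport_iff_eventuallyEq.1 h), dx_zero, Pi.zero_apply]

theorem dy_eq_zero_of_notMem_tsupport {φ : Torus a b → ℝ} {z : Torus a b} (h : z ∉ tsupport φ) :
    dy φ z = 0 := by
  rw [dy_congr (notMem_tsupport_iff_eventuallyEq.1 h), dy_zero, Pi.zero_apply]

/-- Smoothness is local. -/
theorem isSmooth_of_forall_eventuallyEq {φ : Torus a b → ℝ}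
    (h : ∀ z, ∃ ψ, IsSmooth ψ ∧ φ =ᶠ[nhds z] ψ) : IsSmooth φ := by
  rw [isSmooth_iff, contDiff_iff_contDiffAt]
  intro p
  obtain ⟨ψ, hψ, he⟩ := h (torusMk a b p)
  exact (isSmooth_iff.1 hψ).contDiffAt.congr_of_eventuallyEq
    (continuous_torusMk.continuousAt.eventually he)

variable [Fact (0 < a)] [Fact (0 < b)]

theorem memLp_of_continuous {φ : Torus a b → ℝ} (h : Continuous φ) :
    MemLp φ 2 (volume : Measure (Torus a b)) :=
  h.memLp_of_hasCompactSupport (HasCompactSupport.of_compactSpace φ)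

/-- The class in `L²` of a continuous function. -/
def toL2 (φ : Torus a b → ℝ) (h : Continuous φ) : L2 a b := (memLp_of_continuous h).toLp φ

theorem coeFn_toL2 {φ : Torus a b → ℝ} (h : Continuous φ) : toL2 φ h =ᵐ[volume] φ :=
  MemLp.coeFn_toLp _

theorem inner_toL2 {φ ψ : Torus a b → ℝ} (hφ : Continuous φ) (hψ : Continuous ψ) :
    inner ℝ (toL2 φ hφ) (toL2 ψ hψ) = ∫ z, φ z * ψ z := by
  rw [L2.inner_def]
  refine integral_congr_ae ?_
  filter_upwards [coeFn_toL2 hφ, coeFn_toL2 hψ] with z h1 h2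
  rw [h1, h2]
  simp [mul_comm]

theorem norm_sq_toL2 {φ : Torus a b → ℝ} (hφ : Continuous φ) :
    ‖toL2 φ hφ‖ ^ 2 = ∫ z, φ z ^ 2 := by
  rw [← real_inner_self_eq_norm_sq, inner_toL2]
  simp [pow_two]

/-- The class in `L² × L² × L²` of a smooth function and of its first partial derivatives. -/
def gradientTriple (φ : Torus a b → ℝ) (h : IsSmooth φ) : L2 a b × L2 a b × L2 a b :=
  (toL2 φ h.continuous, toL2 (dx φ) h.dx.continuous, toL2 (dy φ) h.dy.continuous)

theorem gradientTriple_mem {C : Set (Torus a b → ℝ)} {φ : Torus a b → ℝ} (h : IsSmooth φ)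
    (hφ : φ ∈ C) : gradientTriple φ h ∈ gradientGraph C :=
  ⟨φ, hφ, coeFn_toL2 h.continuous, coeFn_toL2 h.dx.continuous, coeFn_toL2 h.dy.continuous⟩

theorem exists_eq_gradientTriple {C : Set (Torus a b → ℝ)} (hC : ∀ φ ∈ C, IsSmooth φ)
    {w : L2 a b × L2 a b × L2 a b} (hw : w ∈ gradientGraph C) :
    ∃ φ, ∃ hφ : φ ∈ C, w = gradientTriple φ (hC φ hφ) := by
  obtain ⟨φ, hφ, h1, h2, h3⟩ := hw
  refine ⟨φ, hφ, Prod.ext (Lp.ext ?_) (Prod.ext (Lp.ext ?_) (Lp.ext ?_))⟩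
  · exact h1.trans (coeFn_toL2 (hC φ hφ).continuous).symm
  · exact h2.trans (coeFn_toL2 (hC φ hφ).dx.continuous).symm
  · exact h3.trans (coeFn_toL2 (hC φ hφ).dy.continuous).symm

/-- The gradient graph of a linear space of smooth functions. -/
def gradientSubmodule (C : Submodule ℝ (Torus a b → ℝ)) (hC : ∀ φ ∈ C, IsSmooth φ) :
    Submodule ℝ (L2 a b × L2 a b × L2 a b) where
  carrier := gradientGraph (C : Set (Torus a b → ℝ))
  zero_mem' := by
    refine ⟨0, C.zero_mem, Lp.coeFn_zero _ _ _, ?_, ?_⟩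
    · rw [dx_zero]; exact Lp.coeFn_zero _ _ _
    · rw [dy_zero]; exact Lp.coeFn_zero _ _ _
  add_mem' := by
    rintro u v ⟨φ, hφ, h1, h2, h3⟩ ⟨ψ, hψ, k1, k2, k3⟩
    refine ⟨φ + ψ, C.add_mem hφ hψ, (Lp.coeFn_add _ _).trans (h1.add k1), ?_, ?_⟩
    · rw [dx_add (hC φ hφ) (hC ψ hψ)]
      exact (Lp.coeFn_add _ _).trans (h2.add k2)
    · rw [dy_add (hC φ hφ) (hC ψ hψ)]
      exact (Lp.coeFn_add _ _).trans (h3.add k3)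
  smul_mem' := by
    rintro c u ⟨φ, hφ, h1, h2, h3⟩
    refine ⟨c • φ, C.smul_mem c hφ, (Lp.coeFn_smul _ _).trans (h1.const_smul c), ?_, ?_⟩
    · rw [dx_smul c (hC φ hφ)]
      exact (Lp.coeFn_smul _ _).trans (h2.const_smul c)
    · rw [dy_smul c (hC φ hφ)]
      exact (Lp.coeFn_smul _ _).trans (h3.const_smul c)

/-- The smooth functions with compact support in `ω`, as a linear space. -/
def testSubmodule (ω : Set (Torus a b)) : Submodule ℝ (Torus a b → ℝ) where
  carrier := testFunctions ω
  zero_mem' := ⟨isSmooth_zero, by simp [tsupport]⟩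
  add_mem' := fun {φ ψ} hφ hψ => ⟨hφ.1.add hψ.1,
    (tsupport_add φ ψ).trans (Set.union_subset hφ.2 hψ.2)⟩
  smul_mem' := fun c φ hφ => ⟨hφ.1.smul c,
    (closure_mono (Function.support_const_smul_subset c φ)).trans hφ.2⟩

end SmoothFunctions

-- Fourier series on the torus and Rellich's inequality.

section Fourier

open ComplexConjugate

variable {a b : ℝ}

/-- The exponential monomials on the torus. -/
def torusFourier (a b : ℝ) (n : ℤ × ℤ) : C(Torus a b, ℂ) where
  toFun z := fourier n.1 z.1 * fourier n.2 z.2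
  continuous_toFun := by fun_prop

theorem torusFourier_apply (n : ℤ × ℤ) (z : Torus a b) :
    torusFourier a b n z = fourier n.1 z.1 * fourier n.2 z.2 := rfl

theorem torusFourier_neg (n : ℤ × ℤ) (z : Torus a b) :
    torusFourier a b (-n) z = conj (torusFourier a b n z) := by
  simp only [torusFourier_apply, Prod.fst_neg, Prod.snd_neg, fourier_neg, map_mul]

theorem torusFourier_add (m n : ℤ × ℤ) (z : Torus a b) :
    torusFourier a b (m + n) z = torusFourier a b m z * torusFourier a b n z := by
  simp only [torusFourier_apply, Prod.fst_add, Prod.snd_add, fourier_add]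
  ring

theorem torusFourier_zero (z : Torus a b) : torusFourier a b 0 z = 1 := by
  simp [torusFourier_apply]

/-- The star subalgebra of `C(Torus a b, ℂ)` generated by the exponential monomials. -/
def torusFourierSubalgebra (a b : ℝ) : StarSubalgebra ℂ C(Torus a b, ℂ) where
  toSubalgebra := Algebra.adjoin ℂ (Set.range (torusFourier a b))
  star_mem' := by
    change Algebra.adjoin ℂ (Set.range (torusFourier a b))
      ≤ star (Algebra.adjoin ℂ (Set.range (torusFourier a b)))
    refine Algebra.adjoin_le ?_
    rintro _ ⟨n, rfl⟩
    refine Algebra.subset_adjoin ⟨-n, ?_⟩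
    ext1 z
    simp only [torusFourier_neg, starRingEnd_apply, ContinuousMap.star_apply]

/-- The monomials are closed under multiplication, so Stone–Weierstrass for the algebra gives
density of their linear span. -/
theorem torusFourierSubalgebra_coe :
    (torusFourierSubalgebra a b).toSubalgebra.toSubmodule
      = Submodule.span ℂ (Set.range (torusFourier a b)) := by
  apply Algebra.adjoin_eq_span_of_subset
  refine .trans (fun x ↦ Submonoid.closure_induction (fun _ ↦ id) ⟨0, ?_⟩ ?_) Submodule.subset_span
  · ext z
    exact torusFourier_zero z
  · rintro _ _ _ _ ⟨m, rfl⟩ ⟨n, rfl⟩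
    refine ⟨m + n, ?_⟩
    ext z
    exact torusFourier_add m n z

theorem continuous_torusFourier_re (n : ℤ × ℤ) :
    Continuous fun z => (torusFourier a b n z).re :=
  Complex.continuous_re.comp (torusFourier a b n).continuous

theorem continuous_torusFourier_im (n : ℤ × ℤ) :
    Continuous fun z => (torusFourier a b n z).im :=
  Complex.continuous_im.comp (torusFourier a b n).continuous

theorem hasDerivAt_torusFourier_fst (n : ℤ × ℤ) (x y : ℝ) :
    HasDerivAt (fun t => torusFourier a b n (torusMk a b (t, y)))
      (2 * Real.pi * Complex.I * n.1 / a * torusFourier a b n (torusMk a b (x, y))) x := by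
  have := (hasDerivAt_fourier a n.1 x).mul_const (fourier n.2 (y : AddCircle b))
  rw [mul_assoc] at this
  exact this

theorem hasDerivAt_torusFourier_snd (n : ℤ × ℤ) (x y : ℝ) :
    HasDerivAt (fun t => torusFourier a b n (torusMk a b (x, t)))
      (2 * Real.pi * Complex.I * n.2 / b * torusFourier a b n (torusMk a b (x, y))) y := by
  have := (hasDerivAt_fourier b n.2 y).const_mul (fourier n.1 (x : AddCircle a))
  rw [mul_left_comm] at this
  exact this

variable [Fact (0 < a)] [Fact (0 < b)]

theorem torusFourierSubalgebra_separatesPoints :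
    (torusFourierSubalgebra a b).SeparatesPoints := by
  intro x y hxy
  have ha : a ≠ 0 := (Fact.out : 0 < a).ne'
  have hb : b ≠ 0 := (Fact.out : 0 < b).ne'
  by_cases h1 : x.1 = y.1
  · refine ⟨_, ⟨torusFourier a b (0, 1), Algebra.subset_adjoin ⟨(0, 1), rfl⟩, rfl⟩, ?_⟩
    simp only [torusFourier_apply, fourier_zero, one_mul, fourier_one, ne_eq]
    exact fun h => hxy (Prod.ext h1 (AddCircle.injective_toCircle hb (Circle.ext h)))
  · refine ⟨_, ⟨torusFourier a b (1, 0), Algebra.subset_adjoin ⟨(1, 0), rfl⟩, rfl⟩, ?_⟩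
    simp only [torusFourier_apply, fourier_zero, mul_one, fourier_one, ne_eq]
    exact fun h => h1 (AddCircle.injective_toCircle ha (Circle.ext h))

theorem span_torusFourier_closure_eq_top :
    (Submodule.span ℂ (Set.range (torusFourier a b))).topologicalClosure = ⊤ := by
  rw [← torusFourierSubalgebra_coe]
  exact congr_arg (Subalgebra.toSubmodule <| StarSubalgebra.toSubalgebra ·)
    (ContinuousMap.starSubalgebra_topologicalClosure_eq_top_of_separatesPoints
      (torusFourierSubalgebra a b) torusFourierSubalgebra_separatesPoints)

/-- The invariant probability measure on the torus. -/
def torusHaar (a b : ℝ) [Fact (0 < a)] [Fact (0 < b)] : Measure (Torus a b) :=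
  (AddCircle.haarAddCircle : Measure (AddCircle a)).prod AddCircle.haarAddCircle

instance : IsProbabilityMeasure (torusHaar a b) :=
  inferInstanceAs (IsProbabilityMeasure (Measure.prod _ _))

theorem integral_volume_eq_torusHaar {E : Type*} [NormedAddCommGroup E] [NormedSpace ℝ E]
    (f : Torus a b → E) : ∫ z, f z = (a * b) • ∫ z, f z ∂(torusHaar a b) := by
  have ha : 0 < a := Fact.out
  have hb : 0 < b := Fact.out
  have : (volume : Measure (Torus a b)) = ENNReal.ofReal (a * b) • torusHaar a b := by
    change Measure.prod _ _ = _
    rw [AddCircle.volume_eq_smul_haarAddCircle, AddCircle.volume_eq_smul_haarAddCircle,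
      Measure.prod_smul_left, Measure.prod_smul_right, smul_smul, ENNReal.ofReal_mul ha.le]
    rfl
  rw [this, integral_smul_measure, ENNReal.toReal_ofReal (by positivity)]

theorem integral_fourier_haarAddCircle (n : ℤ) :
    ∫ x : AddCircle a, fourier n x ∂AddCircle.haarAddCircle = if n = 0 then 1 else 0 := by
  have := orthonormal_iff_ite.1 (orthonormal_fourier (T := a)) 0 n
  rw [ContinuousMap.inner_toLp] at this
  simpa [fourier_zero, eq_comm] using this

theorem integral_torusFourier (n : ℤ × ℤ) :
    ∫ z, torusFourier a b n z ∂(torusHaar a b) = if n = 0 then 1 else 0 := by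
  simp only [torusFourier_apply, torusHaar]
  rw [integral_prod_mul (fun x => fourier n.1 x) (fun y => fourier n.2 y),
    integral_fourier_haarAddCircle, integral_fourier_haarAddCircle]
  simp only [Prod.ext_iff, Prod.fst_zero, Prod.snd_zero]
  split_ifs <;> simp_all

theorem orthonormal_torusFourier :
    Orthonormal ℂ fun n => ContinuousMap.toLp (E := ℂ) 2 (torusHaar a b) ℂ (torusFourier a b n) := by
  rw [orthonormal_iff_ite]
  intro m n
  have h : ∀ z, torusFourier a b n z * conj (torusFourier a b m z)
      = torusFourier a b (n - m) z := fun z => by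
    rw [sub_eq_add_neg, torusFourier_add, torusFourier_neg]
  simp only [ContinuousMap.inner_toLp, h, integral_torusFourier, sub_eq_zero, eq_comm]

theorem span_toLp_torusFourier :
    (Submodule.span ℂ (Set.range fun n =>
      ContinuousMap.toLp (E := ℂ) 2 (torusHaar a b) ℂ (torusFourier a b n))).topologicalClosure
      = ⊤ := by
  simpa only [Submodule.map_span, ContinuousLinearMap.coe_coe, ← Set.range_comp,
    Function.comp_def] using
    (ContinuousMap.toLp_denseRange ℂ (torusHaar a b) ℂ
      (by simp : (2 : ENNReal) ≠ ⊤)).topologicalClosure_map_submodule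
      span_torusFourier_closure_eq_top

/-- The Fourier coefficients of a function on the torus. -/
def torusCoeff (f : Torus a b → ℂ) (n : ℤ × ℤ) : ℂ :=
  ∫ z, torusFourier a b (-n) z * f z ∂(torusHaar a b)

/-- Parseval's identity. -/
theorem hasSum_sq_torusCoeff (f : C(Torus a b, ℂ)) :
    HasSum (fun n => ‖torusCoeff f n‖ ^ 2) (∫ z, ‖f z‖ ^ 2 ∂(torusHaar a b)) := by
  let B : HilbertBasis (ℤ × ℤ) ℂ (Lp ℂ 2 (torusHaar a b)) :=
    HilbertBasis.mk orthonormal_torusFourier span_toLp_torusFourier.ge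
  let F := ContinuousMap.toLp (E := ℂ) 2 (torusHaar a b) ℂ f
  have h := B.hasSum_inner_mul_inner F F
  have h1 : ∀ n, inner ℂ (B n) F = torusCoeff f n := by
    intro n
    simp only [B, F, HilbertBasis.coe_mk, ContinuousMap.inner_toLp, torusCoeff, torusFourier_neg,
      mul_comm]
  have h2 : ∀ n, inner ℂ F (B n) * inner ℂ (B n) F = ((‖torusCoeff f n‖ ^ 2 : ℝ) : ℂ) := by
    intro n
    rw [← inner_conj_symm, h1, Complex.conj_mul']
    push_cast; rfl
  have h3 : inner ℂ F F = ((∫ z, ‖f z‖ ^ 2 ∂(torusHaar a b) : ℝ) : ℂ) := by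
    simp only [F, ContinuousMap.inner_toLp]
    rw [← integral_complex_ofReal]
    refine integral_congr_ae (.of_forall fun z => ?_)
    simp only [Complex.mul_conj']
    push_cast; rfl
  simp only [h2, h3] at h
  exact Complex.hasSum_ofReal.1 h

theorem integral_addCircle_eq_zero_of_hasDerivAt {g g' : AddCircle a → ℂ} (hg' : Continuous g')
    (h : ∀ t : ℝ, HasDerivAt (fun t : ℝ => g t) (g' t) t) : ∫ x, g' x = 0 := by
  rw [← AddCircle.intervalIntegral_preimage a 0 g',
    intervalIntegral.integral_eq_sub_of_hasDerivAt (fun t _ => h t)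
      ((hg'.comp (AddCircle.continuous_mk' a)).intervalIntegrable _ _)]
  simp [AddCircle.coe_period]

theorem integrable_of_continuous {f : Torus a b → ℂ} (h : Continuous f) :
    Integrable f (volume : Measure (Torus a b)) :=
  h.integrable_of_hasCompactSupport (HasCompactSupport.of_compactSpace f)

theorem integral_eq_zero_of_hasDerivAt_fst {g g' : Torus a b → ℂ} (hg' : Continuous g')
    (h : ∀ x y : ℝ, HasDerivAt (fun t => g (torusMk a b (t, y))) (g' (torusMk a b (x, y))) x) :
    ∫ z, g' z = 0 := by
  have hi := integrable_of_continuous hg'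
  have := integral_prod_symm g' hi
  rw [show (∫ z, g' z) = ∫ z, g' z ∂(Measure.prod volume volume) from rfl, this]
  refine integral_eq_zero_of_ae (.of_forall fun y => ?_)
  obtain ⟨y, rfl⟩ := QuotientAddGroup.mk_surjective y
  exact integral_addCircle_eq_zero_of_hasDerivAt (g := fun x => g (x, (y : AddCircle b)))
    (by fun_prop) fun t => h t y

theorem integral_eq_zero_of_hasDerivAt_snd {g g' : Torus a b → ℂ} (hg' : Continuous g')
    (h : ∀ x y : ℝ, HasDerivAt (fun t => g (torusMk a b (x, t))) (g' (torusMk a b (x, y))) y) :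
    ∫ z, g' z = 0 := by
  have hi := integrable_of_continuous hg'
  have := integral_prod g' hi
  rw [show (∫ z, g' z) = ∫ z, g' z ∂(Measure.prod volume volume) from rfl, this]
  refine integral_eq_zero_of_ae (.of_forall fun x => ?_)
  obtain ⟨x, rfl⟩ := QuotientAddGroup.mk_surjective x
  exact integral_addCircle_eq_zero_of_hasDerivAt (g := fun y => g ((x : AddCircle a), y))
    (by fun_prop) fun t => h x t

theorem integral_torusHaar_eq_zero {f : Torus a b → ℂ} (h : ∫ z, f z = 0) :
    ∫ z, f z ∂(torusHaar a b) = 0 := by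
  have ha : 0 < a := Fact.out
  have hb : 0 < b := Fact.out
  rw [integral_volume_eq_torusHaar, smul_eq_zero] at h
  exact h.resolve_left (by positivity)

theorem integrable_torusHaar_of_continuous {f : Torus a b → ℂ} (h : Continuous f) :
    Integrable f (torusHaar a b) :=
  h.integrable_of_hasCompactSupport (HasCompactSupport.of_compactSpace f)

/-- A real continuous function, as a complex continuous function. -/
def complexify (φ : Torus a b → ℝ) (h : Continuous φ) : C(Torus a b, ℂ) :=
  ⟨fun z => (φ z : ℂ), Complex.continuous_ofReal.comp h⟩

/-- Integration by parts: the derivative of the periodic function `torusFourier a b (-n) * φ` has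
zero integral. -/
theorem torusCoeff_dx {φ : Torus a b → ℝ} (h : IsSmooth φ) (n : ℤ × ℤ) :
    torusCoeff (complexify (dx φ) h.dx.continuous) n
      = 2 * Real.pi * Complex.I * n.1 / a * torusCoeff (complexify φ h.continuous) n := by
  have hφ := h.continuous
  have hdφ := h.dx.continuous
  have hz := integral_torusHaar_eq_zero (integral_eq_zero_of_hasDerivAt_fst
    (g := fun z => torusFourier a b (-n) z * φ z)
    (g' := fun z => -(2 * Real.pi * Complex.I * n.1 / a) * (torusFourier a b (-n) z * φ z)
      + torusFourier a b (-n) z * dx φ z) (by fun_prop) (fun x y => by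
      refine ((hasDerivAt_torusFourier_fst (-n) x y).mul
        (h.hasDerivAt_fst x y).ofReal_comp).congr_deriv ?_
      simp only [Prod.fst_neg, Int.cast_neg]
      ring))
  rw [integral_add (integrable_torusHaar_of_continuous (by fun_prop))
    (integrable_torusHaar_of_continuous (by fun_prop)), integral_const_mul] at hz
  simp only [torusCoeff, complexify, ContinuousMap.coe_mk]
  linear_combination hz

theorem torusCoeff_dy {φ : Torus a b → ℝ} (h : IsSmooth φ) (n : ℤ × ℤ) :
    torusCoeff (complexify (dy φ) h.dy.continuous) n
      = 2 * Real.pi * Complex.I * n.2 / b * torusCoeff (complexify φ h.continuous) n := by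
  have hφ := h.continuous
  have hdφ := h.dy.continuous
  have hz := integral_torusHaar_eq_zero (integral_eq_zero_of_hasDerivAt_snd
    (g := fun z => torusFourier a b (-n) z * φ z)
    (g' := fun z => -(2 * Real.pi * Complex.I * n.2 / b) * (torusFourier a b (-n) z * φ z)
      + torusFourier a b (-n) z * dy φ z) (by fun_prop) (fun x y => by
      refine ((hasDerivAt_torusFourier_snd (-n) x y).mul
        (h.hasDerivAt_snd x y).ofReal_comp).congr_deriv ?_
      simp only [Prod.snd_neg, Int.cast_neg]
      ring))
  rw [integral_add (integrable_torusHaar_of_continuous (by fun_prop))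
    (integrable_torusHaar_of_continuous (by fun_prop)), integral_const_mul] at hz
  simp only [torusCoeff, complexify, ContinuousMap.coe_mk]
  linear_combination hz

theorem hasSum_sq_torusCoeff_complexify {φ : Torus a b → ℝ} (h : Continuous φ) :
    HasSum (fun n => ‖torusCoeff (complexify φ h) n‖ ^ 2) (‖toL2 φ h‖ ^ 2 / (a * b)) := by
  have ha : 0 < a := Fact.out
  have hb : 0 < b := Fact.out
  have := hasSum_sq_torusCoeff (complexify φ h)
  rw [norm_sq_toL2, integral_volume_eq_torusHaar, smul_eq_mul, mul_div_cancel_left₀ _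
    (by positivity)]
  simpa [complexify] using this

/-- The compactness criterion wants real functionals given by inner products; each complex
coefficient supplies two. -/
theorem norm_sq_torusCoeff_complexify {φ : Torus a b → ℝ} (h : Continuous φ) (n : ℤ × ℤ) :
    ‖torusCoeff (complexify φ h) n‖ ^ 2
      = (inner ℝ (toL2 _ (continuous_torusFourier_re (-n))) (toL2 φ h)
          / (a * b)) ^ 2
        + (inner ℝ (toL2 _ (continuous_torusFourier_im (-n))) (toL2 φ h)
          / (a * b)) ^ 2 := by
  have ha : 0 < a := Fact.out
  have hb : 0 < b := Fact.out
  have hi : Integrable (fun z => torusFourier a b (-n) z * complexify φ h z) (torusHaar a b) :=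
    integrable_torusHaar_of_continuous (by fun_prop)
  rw [inner_toL2, inner_toL2, integral_volume_eq_torusHaar, integral_volume_eq_torusHaar,
    smul_eq_mul, smul_eq_mul, mul_div_cancel_left₀ _ (by positivity),
    mul_div_cancel_left₀ _ (by positivity), ← Complex.normSq_eq_norm_sq, Complex.normSq_apply,
    torusCoeff]
  have h1 := integral_re hi
  have h2 := integral_im hi
  simp only [RCLike.re_to_complex, RCLike.im_to_complex] at h1 h2
  rw [← h1, ← h2, pow_two, pow_two]
  simp [complexify]

/-- The quantitative form of Rellich's theorem. -/
theorem exists_norm_sq_toL2_le {ε : ℝ} (hε : 0 < ε) :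
    ∃ (ι : Type) (_ : Fintype ι) (g : ι → L2 a b), ∀ (φ : Torus a b → ℝ) (h : IsSmooth φ),
      ‖toL2 φ h.continuous‖ ^ 2
        ≤ ε * (‖toL2 (dx φ) h.dx.continuous‖ ^ 2 + ‖toL2 (dy φ) h.dy.continuous‖ ^ 2)
          + ∑ i, (inner ℝ (g i) (toL2 φ h.continuous)) ^ 2 := by
  classical
  have ha : 0 < a := Fact.out
  have hb : 0 < b := Fact.out
  have hab : 0 < a * b := by positivity
  have hpi := Real.pi_pos
  -- Beyond `N` in either frequency, `ε` times the squared symbol of the corresponding derivative is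
  -- at least 1. The bound `1 ≤ N` serves to pass from `N ≤ |m|` to `N ≤ m ^ 2`.
  obtain ⟨N, hN⟩ := exists_nat_ge
    (max 1 (max (1 / (ε * (2 * Real.pi / a) ^ 2)) (1 / (ε * (2 * Real.pi / b) ^ 2))))
  have hN1 : (1 : ℝ) ≤ N := (le_max_left _ _).trans hN
  have hNc : ∀ c : ℝ, 0 < c → 1 / (ε * (2 * Real.pi / c) ^ 2) ≤ N → ∀ m : ℤ,
      m ∉ Finset.Icc (-(N : ℤ)) N → 1 ≤ ε * (2 * Real.pi / c) ^ 2 * (m : ℝ) ^ 2 := by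
    intro c hc hle m hm
    have h1 : (N : ℝ) ≤ |(m : ℝ)| := by
      rw [← Int.cast_abs]
      have : (N : ℤ) ≤ |m| := by
        by_contra hlt
        rw [not_le, abs_lt] at hlt
        exact hm (Finset.mem_Icc.2 ⟨hlt.1.le, hlt.2.le⟩)
      exact_mod_cast this
    have h2 : (N : ℝ) ≤ (m : ℝ) ^ 2 := by
      rw [← sq_abs]; nlinarith
    have h3 : 0 < ε * (2 * Real.pi / c) ^ 2 := by positivity
    rw [div_le_iff₀ h3] at hle
    nlinarith
  let S : Finset (ℤ × ℤ) := Finset.Icc (-(N : ℤ)) N ×ˢ Finset.Icc (-(N : ℤ)) N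
  -- Coefficients use the probability measure and inner products the area; `s` makes the squared
  -- functionals sum to `a * b` times the squared coefficients.
  let s : ℝ := Real.sqrt (1 / (a * b))
  have hs : s ^ 2 = 1 / (a * b) := Real.sq_sqrt (by positivity)
  let gr : ℤ × ℤ → L2 a b := fun n => s • toL2 _ (continuous_torusFourier_re (-n))
  let gi : ℤ × ℤ → L2 a b := fun n => s • toL2 _ (continuous_torusFourier_im (-n))
  refine ⟨S ⊕ S, inferInstance, Sum.elim (fun n => gr n) (fun n => gi n), fun φ h => ?_⟩
  have e0 := hasSum_sq_torusCoeff_complexify h.continuous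
  have e1 := hasSum_sq_torusCoeff_complexify h.dx.continuous
  have e2 := hasSum_sq_torusCoeff_complexify h.dy.continuous
  have e3 : HasSum (fun n => if n ∈ S then ‖torusCoeff (complexify φ h.continuous) n‖ ^ 2 else 0)
      (∑ n ∈ S, ‖torusCoeff (complexify φ h.continuous) n‖ ^ 2) := by
    rw [← Finset.sum_congr rfl (fun n hn => if_pos hn)]
    exact hasSum_sum_of_ne_finset_zero fun n hn => if_neg hn
  -- Termwise comparison: low frequencies are covered by the finite sum, high ones by the
  -- derivatives.
  have hle := hasSum_le (fun n => ?_) e0 (((e1.add e2).mul_left ε).add e3)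
  · have hsum : ∑ i, (inner ℝ (Sum.elim (fun n : S => gr n) (fun n : S => gi n) i)
        (toL2 φ h.continuous)) ^ 2
        = (a * b) * ∑ n ∈ S, ‖torusCoeff (complexify φ h.continuous) n‖ ^ 2 := by
      rw [Fintype.sum_sum_type, ← Finset.sum_add_distrib, Finset.mul_sum, ← Finset.sum_coe_sort S]
      refine Finset.sum_congr rfl fun n _ => ?_
      rw [norm_sq_torusCoeff_complexify]
      simp only [Sum.elim_inl, Sum.elim_inr, gr, gi, real_inner_smul_left, mul_pow, hs]
      field_simp
    rw [hsum]
    have := mul_le_mul_of_nonneg_left hle hab.le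
    calc _ = a * b * (‖toL2 φ h.continuous‖ ^ 2 / (a * b)) := by field_simp
      _ ≤ _ := this
      _ = _ := by field_simp
  · have hx : ‖torusCoeff (complexify (dx φ) h.dx.continuous) n‖ ^ 2
        = (2 * Real.pi / a) ^ 2 * (n.1 : ℝ) ^ 2
          * ‖torusCoeff (complexify φ h.continuous) n‖ ^ 2 := by
      rw [torusCoeff_dx h, norm_mul, mul_pow]
      congr 1
      simp [mul_pow, div_pow]
      ring
    have hy : ‖torusCoeff (complexify (dy φ) h.dy.continuous) n‖ ^ 2
        = (2 * Real.pi / b) ^ 2 * (n.2 : ℝ) ^ 2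
          * ‖torusCoeff (complexify φ h.continuous) n‖ ^ 2 := by
      rw [torusCoeff_dy h, norm_mul, mul_pow]
      congr 1
      simp [mul_pow, div_pow]
      ring
    rw [hx, hy]
    set t := ‖torusCoeff (complexify φ h.continuous) n‖ ^ 2 with ht
    have ht0 : 0 ≤ t := by positivity
    have p1 : 0 ≤ ε * (2 * Real.pi / a) ^ 2 * (n.1 : ℝ) ^ 2 := by positivity
    have p2 : 0 ≤ ε * (2 * Real.pi / b) ^ 2 * (n.2 : ℝ) ^ 2 := by positivity
    split_ifs with hn
    · nlinarith
    · have : 1 ≤ ε * (2 * Real.pi / a) ^ 2 * (n.1 : ℝ) ^ 2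
          + ε * (2 * Real.pi / b) ^ 2 * (n.2 : ℝ) ^ 2 := by
        rw [Finset.mem_product, not_and_or] at hn
        rcases hn with hn | hn
        · have := hNc a ha
            ((le_max_left _ _).trans ((le_max_right _ _).trans hN)) _ hn
          linarith
        · have := hNc b hb
            ((le_max_right _ _).trans ((le_max_right _ _).trans hN)) _ hn
          linarith
      nlinarith

end Fourier

-- From a compactly embedded form domain to eigenvectors.

section AbstractForms

variable {H : Type*} [NormedAddCommGroup H] [InnerProductSpace ℝ H]

/-- A Hilbert space structure on the triples of elements of `H`. -/
structure TripleModel (H E : Type*) [NormedAddCommGroup H] [InnerProductSpace ℝ H]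
    [NormedAddCommGroup E] [InnerProductSpace ℝ E] where
  /-- The triple represented by an element of the model. -/
  toEquiv : E ≃L[ℝ] H × H × H
  inner_eq : ∀ x y : E, inner ℝ x y = inner ℝ (toEquiv x).1 (toEquiv y).1
    + (inner ℝ (toEquiv x).2.1 (toEquiv y).2.1 + inner ℝ (toEquiv x).2.2 (toEquiv y).2.2)

/-- The model given by the `L²` product. -/
def withLpModel (H : Type*) [NormedAddCommGroup H] [InnerProductSpace ℝ H] :
    TripleModel H (WithLp 2 (H × WithLp 2 (H × H))) where
  toEquiv := (WithLp.prodContinuousLinearEquiv 2 ℝ H (WithLp 2 (H × H))).trans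
    ((ContinuousLinearEquiv.refl ℝ H).prodCongr (WithLp.prodContinuousLinearEquiv 2 ℝ H H))
  inner_eq x y := by
    rw [WithLp.prod_inner_apply, WithLp.prod_inner_apply]
    rfl

variable {E : Type*} [NormedAddCommGroup E] [InnerProductSpace ℝ E] (T : TripleModel H E)

/-- The norm of `H × H × H` is a maximum, so Hilbert space arguments take place in `E`, which has
the same topology; on gradient triples its norm is the H¹ norm. -/
theorem TripleModel.norm_sq_eq (x : E) :
    ‖x‖ ^ 2 = ‖(T.toEquiv x).1‖ ^ 2
      + (‖(T.toEquiv x).2.1‖ ^ 2 + ‖(T.toEquiv x).2.2‖ ^ 2) := by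
  simp only [← real_inner_self_eq_norm_sq, T.inner_eq]

/-- The closure of a space of triples, as a Hilbert space. -/
def formSpace (S : Submodule ℝ (H × H × H)) : Submodule ℝ E :=
  S.topologicalClosure.comap (T.toEquiv : E →ₗ[ℝ] H × H × H)

variable (S : Submodule ℝ (H × H × H))

theorem isClosed_formSpace : IsClosed (formSpace T S : Set E) :=
  S.isClosed_topologicalClosure.preimage T.toEquiv.continuous

instance [CompleteSpace E] : CompleteSpace (formSpace T S) :=
  (isClosed_formSpace T S).completeSpace_coe

/-- The first component, as an operator on the form space. -/
def formEmbedding : formSpace T S →L[ℝ] H :=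
  ((ContinuousLinearMap.fst ℝ H (H × H)).comp (T.toEquiv : E →L[ℝ] H × H × H)).comp (formSpace T S).subtypeL

theorem formEmbedding_apply (v : formSpace T S) : formEmbedding T S v = (T.toEquiv v).1 := rfl

/-- The first component of a triple is controlled, up to a small multiple of the other ones, by
finitely many continuous linear functionals. -/
def IsCompactlyEmbedded : Prop :=
  ∀ ε > 0, ∃ (ι : Type) (_ : Fintype ι) (g : ι → H), ∀ w ∈ S,
    ‖w.1‖ ^ 2 ≤ ε * (‖w.2.1‖ ^ 2 + ‖w.2.2‖ ^ 2) + ∑ i, (inner ℝ (g i) w.1) ^ 2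

variable {S} [CompleteSpace E] [CompleteSpace H]

/-- The defining inequality is a closed condition, hence survives on the closure of `S`, and the
gradient part is at most the full squared norm. -/
theorem IsCompactlyEmbedded.isCompactOperator (hS : IsCompactlyEmbedded S) :
    IsCompactOperator (formEmbedding T S) := by
  refine isCompactOperator_of_norm_sq_le (formEmbedding T S) fun ε hε => ?_
  obtain ⟨ι, hι, g, hg⟩ := hS ε hε
  refine ⟨ι, hι, g, fun v => ?_⟩
  have hcl : IsClosed {w : H × H × H |
      ‖w.1‖ ^ 2 ≤ ε * (‖w.2.1‖ ^ 2 + ‖w.2.2‖ ^ 2) + ∑ i, (inner ℝ (g i) w.1) ^ 2} :=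
    isClosed_le (by fun_prop) (by fun_prop)
  have := closure_minimal (s := (S : Set (H × H × H))) hg hcl v.2
  have hn := T.norm_sq_eq v
  rw [Submodule.coe_norm, hn, formEmbedding_apply]
  have h0 : 0 ≤ ε * ‖(T.toEquiv v).1‖ ^ 2 := by positivity
  have h1 : ‖(T.toEquiv v).1‖ ^ 2
      ≤ ε * (‖(T.toEquiv v).2.1‖ ^ 2 + ‖(T.toEquiv v).2.2‖ ^ 2)
        + ∑ i, (inner ℝ (g i) (T.toEquiv v).1) ^ 2 := this
  linarith

variable (S) in
/-- The operator `J† J` on the form space, where `J` is the first component. -/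
def formOperator : formSpace T S →L[ℝ] formSpace T S :=
  (ContinuousLinearMap.adjoint (formEmbedding T S)).comp (formEmbedding T S)

/-- The Rayleigh quotient of `formOperator` is thus the L² norm squared over the H¹ norm squared:
large values mean low energy. -/
theorem inner_formOperator (v w : formSpace T S) :
    inner ℝ (formOperator T S v) w = inner ℝ (formEmbedding T S v) (formEmbedding T S w) :=
  ContinuousLinearMap.adjoint_inner_left (formEmbedding T S) w (formEmbedding T S v)

theorem isSymmetric_formOperator :
    (formOperator T S : formSpace T S →ₗ[ℝ] formSpace T S).IsSymmetric := by
  intro v w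
  change inner ℝ (formOperator T S v) w = inner ℝ v (formOperator T S w)
  rw [inner_formOperator, real_inner_comm, ← inner_formOperator, real_inner_comm]

/-- The H¹ product is the L² product plus the Dirichlet form; testing the eigenvalue equation
against `r` and solving for the form gives the factor `1 / κ - 1`. -/
theorem form_eq_of_formOperator_eq {v : formSpace T S} {κ : ℝ} (hκ : 0 < κ)
    (h : formOperator T S v = κ • v) {r : H × H × H} (hr : r ∈ S.topologicalClosure) :
    inner ℝ (T.toEquiv v).2.1 r.2.1 + inner ℝ (T.toEquiv v).2.2 r.2.2
      = (1 / κ - 1) * inner ℝ (T.toEquiv v).1 r.1 := by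
  have hr' : T.toEquiv.symm r ∈ formSpace T S := by
    change T.toEquiv (T.toEquiv.symm r) ∈ S.topologicalClosure
    rwa [T.toEquiv.apply_symm_apply]
  have := inner_formOperator T v ⟨T.toEquiv.symm r, hr'⟩
  rw [h, real_inner_smul_left, Submodule.coe_inner, T.inner_eq, formEmbedding_apply,
    formEmbedding_apply, ContinuousLinearEquiv.apply_symm_apply] at this
  field_simp
  linarith

theorem norm_sq_sum_smul_of_orthogonal {E : Type*} [NormedAddCommGroup E] [InnerProductSpace ℝ E]
    {ι : Type*} [Fintype ι] {f : ι → E} (hf : ∀ i j, i ≠ j → inner ℝ (f i) (f j) = 0)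
    (t : ι → ℝ) : ‖∑ i, t i • f i‖ ^ 2 = ∑ i, t i ^ 2 * ‖f i‖ ^ 2 := by
  rw [← real_inner_self_eq_norm_sq, sum_inner]
  refine Finset.sum_congr rfl fun i _ => ?_
  rw [inner_sum, Finset.sum_eq_single i]
  · rw [real_inner_smul_left, real_inner_smul_right, real_inner_self_eq_norm_sq]
    ring
  · intro j _ hj
    rw [real_inner_smul_left, real_inner_smul_right, hf i j hj.symm]
    ring
  · simp

/-- Orthogonality in all three components propagates the energy bound from the `w i` to their span,
where the H¹ norm squared is at most `1 + Λ` times the L² norm squared. The gap `Λ < Λ'` becomes the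
spectral gap required by `exists_eigenvectors_of_rayleigh_ge`. -/
theorem IsCompactlyEmbedded.exists_eigenvectors_of_model (T : TripleModel H E)
    (hS : IsCompactlyEmbedded S) {k : ℕ} {Λ Λ' : ℝ}
    (hΛ : 0 ≤ Λ) (hΛ' : Λ < Λ') (w : Fin k → H × H × H) (hwS : ∀ i, w i ∈ S)
    (hw0 : ∀ i, (w i).1 ≠ 0)
    (hw : ∀ i j, i ≠ j → inner ℝ (w i).1 (w j).1 = 0 ∧ inner ℝ (w i).2.1 (w j).2.1 = 0 ∧
      inner ℝ (w i).2.2 (w j).2.2 = 0)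
    (hle : ∀ i, ‖(w i).2.1‖ ^ 2 + ‖(w i).2.2‖ ^ 2 ≤ Λ * ‖(w i).1‖ ^ 2) :
    ∃ u : Fin k → H × H × H, (∀ i, u i ∈ S.topologicalClosure) ∧
      LinearIndependent ℝ (fun i => (u i).1) ∧
      ∀ i, ∃ μ ≤ Λ', ∀ r ∈ S.topologicalClosure,
        inner ℝ (u i).2.1 r.2.1 + inner ℝ (u i).2.2 r.2.2 = μ * inner ℝ (u i).1 r.1 := by
  have hmem : ∀ i, T.toEquiv.symm (w i) ∈ formSpace T S := fun i => by
    change T.toEquiv (T.toEquiv.symm (w i)) ∈ S.topologicalClosure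
    rw [T.toEquiv.apply_symm_apply]
    exact S.le_topologicalClosure (hwS i)
  let x : Fin k → formSpace T S := fun i => ⟨T.toEquiv.symm (w i), hmem i⟩
  have hxJ : ∀ i, formEmbedding T S (x i) = (w i).1 := fun i => by
    rw [formEmbedding_apply, T.toEquiv.apply_symm_apply]
  have horth : ∀ i j, i ≠ j → inner ℝ (x i) (x j) = 0 := fun i j hij => by
    obtain ⟨h1, h2, h3⟩ := hw i j hij
    rw [Submodule.coe_inner, T.inner_eq]
    simp only [x, ContinuousLinearEquiv.apply_symm_apply, h1, h2, h3, add_zero]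
  have hJ : ∀ i j, i ≠ j → inner ℝ (formEmbedding T S (x i)) (formEmbedding T S (x j)) = 0 :=
    fun i j hij => by rw [hxJ, hxJ]; exact (hw i j hij).1
  have hlin : LinearIndependent ℝ x :=
    linearIndependent_of_ne_zero_of_inner_eq_zero
      (fun i h => hw0 i (by rw [← hxJ, h, map_zero])) fun i j hij => horth i j hij
  have hxle : ∀ i, ‖x i‖ ^ 2 ≤ (1 + Λ) * ‖formEmbedding T S (x i)‖ ^ 2 := fun i => by
    rw [Submodule.coe_norm, T.norm_sq_eq, hxJ]
    have := hle i
    simp only [x, ContinuousLinearEquiv.apply_symm_apply]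
    linarith
  have hc : 1 / (1 + Λ') < 1 / (1 + Λ) := by
    apply one_div_lt_one_div_of_lt <;> linarith
  have hc0 : 0 < 1 / (1 + Λ') := by
    apply one_div_pos.2; linarith
  obtain ⟨v, hv, hκ⟩ := exists_eigenvectors_of_rayleigh_ge (formOperator T S)
    ((hS.isCompactOperator T).clm_comp (ContinuousLinearMap.adjoint (formEmbedding T S))) (isSymmetric_formOperator T) hc hlin (by
      intro y hy
      obtain ⟨t, rfl⟩ := (Submodule.mem_span_range_iff_exists_fun ℝ).1 hy
      rw [inner_formOperator, real_inner_self_eq_norm_sq, norm_sq_sum_smul_of_orthogonal horth,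
        map_sum]
      simp only [map_smul]
      rw [norm_sq_sum_smul_of_orthogonal hJ, one_div_mul_eq_div,
        div_le_iff₀ (by linarith), Finset.sum_mul]
      refine Finset.sum_le_sum fun i _ => ?_
      have := mul_le_mul_of_nonneg_left (hxle i) (sq_nonneg (t i))
      linarith)
  choose κ hκc hκ using hκ
  have hκ0 : ∀ i, 0 < κ i := fun i => hc0.trans_le (hκc i)
  refine ⟨fun i => T.toEquiv (v i), fun i => (v i).2, ?_, fun i => ⟨1 / κ i - 1, ?_,
    fun r hr => form_eq_of_formOperator_eq T (hκ0 i) (hκ i) hr⟩⟩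
  -- Injectivity of `J` on the whole form space is not needed: a relation among the `J (v i)` is
  -- killed by `J†`, and `J† J` only multiplies each `v i` by `κ i ≠ 0`.
  · change LinearIndependent ℝ (fun i => formEmbedding T S (v i))
    rw [Fintype.linearIndependent_iff] at hv ⊢
    intro t ht i
    have h1 : formEmbedding T S (∑ i, t i • v i) = 0 := by
      rw [map_sum]; simpa only [map_smul] using ht
    have h2 : formOperator T S (∑ i, t i • v i) = 0 := by
      rw [formOperator, ContinuousLinearMap.comp_apply, h1, map_zero]
    rw [map_sum] at h2
    simp only [map_smul, hκ, smul_smul] at h2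
    exact (mul_eq_zero.1 (hv _ h2 i)).resolve_right (hκ0 i).ne'
  · have := one_div_le_one_div_of_le hc0 (hκc i)
    rw [one_div_one_div] at this
    linarith

theorem IsCompactlyEmbedded.exists_eigenvectors (hS : IsCompactlyEmbedded S) {k : ℕ} {Λ Λ' : ℝ}
    (hΛ : 0 ≤ Λ) (hΛ' : Λ < Λ') (w : Fin k → H × H × H) (hwS : ∀ i, w i ∈ S)
    (hw0 : ∀ i, (w i).1 ≠ 0)
    (hw : ∀ i j, i ≠ j → inner ℝ (w i).1 (w j).1 = 0 ∧ inner ℝ (w i).2.1 (w j).2.1 = 0 ∧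
      inner ℝ (w i).2.2 (w j).2.2 = 0)
    (hle : ∀ i, ‖(w i).2.1‖ ^ 2 + ‖(w i).2.2‖ ^ 2 ≤ Λ * ‖(w i).1‖ ^ 2) :
    ∃ u : Fin k → H × H × H, (∀ i, u i ∈ S.topologicalClosure) ∧
      LinearIndependent ℝ (fun i => (u i).1) ∧
      ∀ i, ∃ μ ≤ Λ', ∀ r ∈ S.topologicalClosure,
        inner ℝ (u i).2.1 r.2.1 + inner ℝ (u i).2.2 r.2.2 = μ * inner ℝ (u i).1 r.1 :=
  IsCompactlyEmbedded.exists_eigenvectors_of_model (withLpModel H) hS hΛ hΛ' w hwS hw0 hw hle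

end AbstractForms

-- Min-max bounds for the eigenvalues.

section Variational

variable {a b : ℝ}

/-- The squared norm of the gradient. -/
def gradSq (φ : Torus a b → ℝ) (z : Torus a b) : ℝ := dx φ z ^ 2 + dy φ z ^ 2

theorem IsSmooth.continuous_gradSq {φ : Torus a b → ℝ} (h : IsSmooth φ) :
    Continuous (gradSq φ) :=
  (h.dx.continuous.pow 2).add (h.dy.continuous.pow 2)

variable [Fact (0 < a)] [Fact (0 < b)]

theorem integrable_of_continuous_real {f : Torus a b → ℝ} (h : Continuous f) :
    Integrable f (volume : Measure (Torus a b)) :=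
  h.integrable_of_hasCompactSupport (HasCompactSupport.of_compactSpace f)

theorem integral_gradSq {φ : Torus a b → ℝ} (h : IsSmooth φ) :
    ∫ z, gradSq φ z
      = ‖toL2 (dx φ) h.dx.continuous‖ ^ 2 + ‖toL2 (dy φ) h.dy.continuous‖ ^ 2 := by
  rw [norm_sq_toL2, norm_sq_toL2, ← integral_add
    (integrable_of_continuous_real (by have := h.dx.continuous; fun_prop))
    (integrable_of_continuous_real (by have := h.dy.continuous; fun_prop))]
  rfl

theorem nonneg_of_isEigenfunction {C : Set (Torus a b → ℝ)} {μ : ℝ} {u : L2 a b}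
    (h : IsEigenfunction C μ u) : 0 ≤ μ := by
  obtain ⟨hu, -, p, q, hpq, hf⟩ := h
  have := hf u p q hpq
  rw [real_inner_smul_left, real_inner_self_eq_norm_sq, real_inner_self_eq_norm_sq,
    real_inner_self_eq_norm_sq] at this
  have hpos : 0 < ‖u‖ ^ 2 := by positivity
  by_contra hμ
  rw [not_le] at hμ
  have := mul_neg_of_neg_of_pos hμ hpos
  nlinarith [sq_nonneg ‖p‖, sq_nonneg ‖q‖]

/-- The bounds `t` below which there are at least `j` eigenvalues. -/
def spectralBounds (C : Set (Torus a b → ℝ)) (j : ℕ) : Set ℝ :=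
  {t : ℝ | ∃ u : Fin j → L2 a b, LinearIndependent ℝ u ∧
    ∀ i, ∃ μ ≤ t, IsEigenfunction C μ (u i)}

/-- `1 ≤ j` provides an eigenfunction, so nonnegativity of the spectrum bounds the set below and the
infimum is a genuine one; for `j = 0` the set is all of `ℝ`. -/
theorem eigenvalue_le_of_mem {C : Set (Torus a b → ℝ)} {j : ℕ} (hj : 1 ≤ j) {t : ℝ}
    (ht : t ∈ spectralBounds C j) : eigenvalue C j ≤ t := by
  refine csInf_le ⟨0, ?_⟩ ht
  rintro s ⟨u, -, hu⟩
  obtain ⟨μ, hμ, h⟩ := hu ⟨0, hj⟩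
  exact (nonneg_of_isEigenfunction h).trans hμ

variable {C : Submodule ℝ (Torus a b → ℝ)}

/-- Rellich's theorem. -/
theorem isCompactlyEmbedded_gradientSubmodule (hC : ∀ φ ∈ C, IsSmooth φ) :
    IsCompactlyEmbedded (gradientSubmodule C hC) := by
  intro ε hε
  obtain ⟨ι, hι, g, hg⟩ := exists_norm_sq_toL2_le (a := a) (b := b) hε
  refine ⟨ι, hι, g, fun w hw => ?_⟩
  obtain ⟨φ, hφ, rfl⟩ := exists_eq_gradientTriple hC hw
  exact hg φ (hC φ hφ)

theorem fst_mem_closure_classes {C : Set (Torus a b → ℝ)} {w : L2 a b × L2 a b × L2 a b}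
    (hw : w ∈ formDomain C) : w.1 ∈ closure (classes C) := by
  have hsub : (Prod.fst : L2 a b × L2 a b × L2 a b → L2 a b) '' gradientGraph C ⊆ classes C := by
    rintro _ ⟨w, ⟨φ, hφ, h1, -⟩, rfl⟩
    exact ⟨φ, hφ, h1⟩
  exact closure_mono hsub (image_closure_subset_closure_image continuous_fst ⟨_, hw, rfl⟩)

/-- The variational upper bound for eigenvalues, for test functions with disjoint supports. -/
theorem mem_spectralBounds_of_disjoint (hC : ∀ φ ∈ C, IsSmooth φ) {k : ℕ} {Λ Λ' : ℝ} (hΛ : 0 ≤ Λ)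
    (hΛ' : Λ < Λ') (φ : Fin k → Torus a b → ℝ) (hφ : ∀ i, φ i ∈ C)
    (hdisj : ∀ i j, i ≠ j → Disjoint (tsupport (φ i)) (tsupport (φ j)))
    (hpos : ∀ i, 0 < ∫ z, φ i z ^ 2)
    (hle : ∀ i, ∫ z, gradSq (φ i) z ≤ Λ * ∫ z, φ i z ^ 2) :
    Λ' ∈ spectralBounds (C : Set (Torus a b → ℝ)) k := by
  have hout : ∀ i j, i ≠ j → ∀ z, z ∉ tsupport (φ i) ∨ z ∉ tsupport (φ j) := fun i j hij z => by
    rw [← not_and_or]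
    exact fun h => Set.disjoint_left.1 (hdisj i j hij) h.1 h.2
  have h0 : ∀ i j, i ≠ j → inner ℝ (toL2 (φ i) (hC _ (hφ i)).continuous)
      (toL2 (φ j) (hC _ (hφ j)).continuous) = 0 := fun i j hij => by
    rw [inner_toL2]
    refine integral_eq_zero_of_ae (.of_forall fun z => ?_)
    rcases hout i j hij z with h | h <;> simp [image_eq_zero_of_notMem_tsupport h]
  have h1 : ∀ i j, i ≠ j → inner ℝ (toL2 (dx (φ i)) (hC _ (hφ i)).dx.continuous)
      (toL2 (dx (φ j)) (hC _ (hφ j)).dx.continuous) = 0 := fun i j hij => by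
    rw [inner_toL2]
    refine integral_eq_zero_of_ae (.of_forall fun z => ?_)
    rcases hout i j hij z with h | h <;> simp [dx_eq_zero_of_notMem_tsupport h]
  have h2 : ∀ i j, i ≠ j → inner ℝ (toL2 (dy (φ i)) (hC _ (hφ i)).dy.continuous)
      (toL2 (dy (φ j)) (hC _ (hφ j)).dy.continuous) = 0 := fun i j hij => by
    rw [inner_toL2]
    refine integral_eq_zero_of_ae (.of_forall fun z => ?_)
    rcases hout i j hij z with h | h <;> simp [dy_eq_zero_of_notMem_tsupport h]
  have hne : ∀ i, toL2 (φ i) (hC _ (hφ i)).continuous ≠ 0 := fun i h => by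
    have := norm_sq_toL2 (hC _ (hφ i)).continuous
    rw [h, norm_zero, zero_pow two_ne_zero] at this
    exact (hpos i).ne this
  have hle' : ∀ i, ‖toL2 (dx (φ i)) (hC _ (hφ i)).dx.continuous‖ ^ 2
      + ‖toL2 (dy (φ i)) (hC _ (hφ i)).dy.continuous‖ ^ 2
      ≤ Λ * ‖toL2 (φ i) (hC _ (hφ i)).continuous‖ ^ 2 := fun i => by
    rw [← integral_gradSq (hC _ (hφ i)), norm_sq_toL2]
    exact hle i
  obtain ⟨u, hu, hlin, he⟩ := (isCompactlyEmbedded_gradientSubmodule hC).exists_eigenvectors hΛ hΛ'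
    (fun i => gradientTriple (φ i) (hC _ (hφ i))) (fun i => gradientTriple_mem _ (hφ i))
    hne (fun i j hij => ⟨h0 i j hij, h1 i j hij, h2 i j hij⟩) hle'
  refine ⟨fun i => (u i).1, hlin, fun i => ?_⟩
  obtain ⟨μ, hμ, hi⟩ := he i
  refine ⟨μ, hμ, hlin.ne_zero i, ?_, (u i).2.1, (u i).2.2, hu i, fun v r s hv => ?_⟩
  · exact fst_mem_closure_classes ((gradientSubmodule C hC).topologicalClosure.smul_mem μ (hu i))
  · rw [real_inner_smul_left]
    exact hi (v, r, s) hv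

theorem eigenvalue_le_of_disjoint (hC : ∀ φ ∈ C, IsSmooth φ) {k : ℕ} (hk : 1 ≤ k) {Λ : ℝ}
    (φ : Fin k → Torus a b → ℝ) (hφ : ∀ i, φ i ∈ C)
    (hdisj : ∀ i j, i ≠ j → Disjoint (tsupport (φ i)) (tsupport (φ j)))
    (hpos : ∀ i, 0 < ∫ z, φ i z ^ 2)
    (hle : ∀ i, ∫ z, gradSq (φ i) z ≤ Λ * ∫ z, φ i z ^ 2) :
    eigenvalue (C : Set (Torus a b → ℝ)) k ≤ Λ := by
  have hΛ : 0 ≤ Λ := by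
    have h1 : 0 ≤ ∫ z, gradSq (φ ⟨0, hk⟩) z := integral_nonneg fun z => by
      unfold gradSq; positivity
    exact nonneg_of_mul_nonneg_left (h1.trans (hle _)) (hpos _)
  refine le_of_forall_gt_imp_ge_of_dense fun Λ' hΛ' => ?_
  exact eigenvalue_le_of_mem hk (mem_spectralBounds_of_disjoint hC hΛ hΛ' φ hφ hdisj hpos hle)

/-- The case of a single test function, with its own Rayleigh quotient as bound. -/
theorem eigenvalue_one_mul_le (hC : ∀ φ ∈ C, IsSmooth φ) {φ : Torus a b → ℝ} (hφ : φ ∈ C) (hpos : 0 < ∫ z, φ z ^ 2) :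
    eigenvalue (C : Set (Torus a b → ℝ)) 1 * ∫ z, φ z ^ 2 ≤ ∫ z, gradSq φ z := by
  rw [← le_div_iff₀ hpos]
  refine eigenvalue_le_of_disjoint hC le_rfl (fun _ => φ) (fun _ => hφ)
    (fun i j hij => absurd (Subsingleton.elim i j) hij) (fun _ => hpos) fun _ => ?_
  rw [div_mul_cancel₀ _ hpos.ne']

/-- An eigenfunction with eigenvalue below `t` satisfies the strict inequality, which is an open
condition, and it lies in the closure of the gradient graph. -/
theorem exists_gradSq_lt (hC : ∀ φ ∈ C, IsSmooth φ) (hne : ∃ φ ∈ C, 0 < ∫ z, φ z ^ 2) {t : ℝ}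
    (ht : eigenvalue (C : Set (Torus a b → ℝ)) 1 < t) :
    ∃ φ ∈ C, 0 < ∫ z, φ z ^ 2 ∧ ∫ z, gradSq φ z < t * ∫ z, φ z ^ 2 := by
  obtain ⟨ψ, hψ, hpos⟩ := hne
  have hψ0 : 0 ≤ ∫ z, gradSq ψ z := integral_nonneg fun z => by
    unfold gradSq; positivity
  -- The infimum must be over a nonempty set, not the default value of `sInf ∅`; adding 1 gives the
  -- strict margin.
  have hmem : (∫ z, gradSq ψ z) / (∫ z, ψ z ^ 2) + 1
      ∈ spectralBounds (C : Set (Torus a b → ℝ)) 1 :=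
    mem_spectralBounds_of_disjoint hC (div_nonneg hψ0 hpos.le) (lt_add_one _) (fun _ => ψ)
      (fun _ => hψ) (fun i j hij => absurd (Subsingleton.elim i j) hij) (fun _ => hpos)
      fun _ => by rw [div_mul_cancel₀ _ hpos.ne']
  obtain ⟨s, ⟨u, -, hu⟩, hst⟩ := exists_lt_of_csInf_lt ⟨_, hmem⟩ ht
  obtain ⟨μ, hμ, hu0, -, p, q, hpq, hf⟩ := hu 0
  have he := hf _ _ _ hpq
  rw [real_inner_smul_left, real_inner_self_eq_norm_sq, real_inner_self_eq_norm_sq,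
    real_inner_self_eq_norm_sq] at he
  have hopen : IsOpen {w : L2 a b × L2 a b × L2 a b |
      ‖w.2.1‖ ^ 2 + ‖w.2.2‖ ^ 2 < t * ‖w.1‖ ^ 2} := isOpen_lt (by fun_prop) (by fun_prop)
  have hin : (u 0, p, q) ∈ {w : L2 a b × L2 a b × L2 a b |
      ‖w.2.1‖ ^ 2 + ‖w.2.2‖ ^ 2 < t * ‖w.1‖ ^ 2} := by
    have h0 : 0 < ‖u 0‖ ^ 2 := by positivity
    have : μ * ‖u 0‖ ^ 2 < t * ‖u 0‖ ^ 2 := by gcongr; linarith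
    exact he.trans_lt this
  obtain ⟨w, hw1, hw2⟩ := mem_closure_iff.1 hpq _ hopen hin
  obtain ⟨φ, hφ, rfl⟩ := exists_eq_gradientTriple hC hw2
  have hlt : ∫ z, gradSq φ z < t * ∫ z, φ z ^ 2 := by
    rw [integral_gradSq (hC φ hφ), ← norm_sq_toL2 (hC φ hφ).continuous]
    exact hw1
  have hφ0 : 0 ≤ ∫ z, gradSq φ z := integral_nonneg fun z => by
    unfold gradSq; positivity
  refine ⟨φ, hφ, ?_, hlt⟩
  have h1 : 0 ≤ ∫ z, φ z ^ 2 := integral_nonneg fun z => sq_nonneg _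
  refine lt_of_le_of_ne h1 fun h => ?_
  rw [← h, mul_zero] at hlt
  linarith

end Variational

-- Test functions in an arbitrary nonempty open set.

section Bumps

variable {a b : ℝ}

theorem isSmooth_comp_re_toCircle {f : ℝ → ℝ} (hf : ContDiff ℝ ((⊤ : ℕ∞) : WithTop ℕ∞) f) (c : ℝ)
    (z₀ : Torus a b) :
    IsSmooth fun z : Torus a b => f (((AddCircle.toCircle (z.1 - z₀.1) : Circle) : ℂ).re
      + ((AddCircle.toCircle (z.2 - z₀.2) : Circle) : ℂ).re - c) := by
  obtain ⟨⟨x₀, y₀⟩, rfl⟩ := torusMk_surjective z₀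
  have hcos : ∀ (T : ℝ) (x : ℝ), ((AddCircle.toCircle (x : AddCircle T) : Circle) : ℂ).re
      = Real.cos (2 * Real.pi / T * x) := fun T x => by
    rw [AddCircle.toCircle_apply_mk, Circle.coe_exp, Complex.exp_ofReal_mul_I_re]
  have : (fun z : Torus a b => f (((AddCircle.toCircle (z.1 - (torusMk a b (x₀, y₀)).1) : Circle) : ℂ).re
      + ((AddCircle.toCircle (z.2 - (torusMk a b (x₀, y₀)).2) : Circle) : ℂ).re - c)) ∘ torusMk a b
      = fun p => f (Real.cos (2 * Real.pi / a * (p.1 - x₀))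
        + Real.cos (2 * Real.pi / b * (p.2 - y₀)) - c) := by
    funext p
    simp only [Function.comp_apply, torusMk, ← AddCircle.coe_sub, hcos]
  rw [isSmooth_iff, this]
  exact hf.comp (by fun_prop)

variable [Fact (0 < a)] [Fact (0 < b)]

theorem circle_eq_one_of_re_eq_one {w : Circle} (h : (w : ℂ).re = 1) : w = 1 := by
  have h1 : Complex.normSq (w : ℂ) = 1 := by simp
  rw [Complex.normSq_apply, h] at h1
  refine Circle.ext (Complex.ext (by simpa using h) ?_)
  have : (w : ℂ).im * (w : ℂ).im = 0 := by linarith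
  simpa using this

theorem circle_re_le_one (w : Circle) : (w : ℂ).re ≤ 1 :=
  (Complex.re_le_norm _).trans_eq (Circle.norm_coe w)

/-- A non-empty open set supports a non-trivial test function. -/
theorem exists_testFunction {U : Set (Torus a b)} (hU : IsOpen U) (hne : U.Nonempty) :
    ∃ φ ∈ testSubmodule U, 0 < ∫ z, φ z ^ 2 := by
  obtain ⟨z₀, hz₀⟩ := hne
  have ha : a ≠ 0 := (Fact.out : 0 < a).ne'
  have hb : b ≠ 0 := (Fact.out : 0 < b).ne'
  -- A sum of two cosines, with unique maximum 2 at `z₀`; compactness then keeps it at most some `c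
  -- < 2` off `U`.
  let F : Torus a b → ℝ := fun z => ((AddCircle.toCircle (z.1 - z₀.1) : Circle) : ℂ).re
      + ((AddCircle.toCircle (z.2 - z₀.2) : Circle) : ℂ).re
  have hF : Continuous F := by
    have h1 := AddCircle.continuous_toCircle (T := a)
    have h2 := AddCircle.continuous_toCircle (T := b)
    exact (Complex.continuous_re.comp (continuous_subtype_val.comp (h1.comp (by fun_prop)))).add
      (Complex.continuous_re.comp (continuous_subtype_val.comp (h2.comp (by fun_prop))))
  have hF₀ : F z₀ = 2 := by
    simp only [F, sub_self, AddCircle.toCircle_zero, Circle.coe_one, Complex.one_re]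
    norm_num
  have hlt : ∀ z, z ≠ z₀ → F z < 2 := by
    intro z hz
    have h1 := circle_re_le_one (AddCircle.toCircle (z.1 - z₀.1))
    have h2 := circle_re_le_one (AddCircle.toCircle (z.2 - z₀.2))
    refine lt_of_le_of_ne (by simp only [F]; linarith) fun h => hz ?_
    simp only [F] at h
    have e1 := circle_eq_one_of_re_eq_one (w := AddCircle.toCircle (z.1 - z₀.1)) (by linarith)
    have e2 := circle_eq_one_of_re_eq_one (w := AddCircle.toCircle (z.2 - z₀.2)) (by linarith)
    rw [← AddCircle.toCircle_zero] at e1 e2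
    exact Prod.ext (sub_eq_zero.1 (AddCircle.injective_toCircle ha e1))
      (sub_eq_zero.1 (AddCircle.injective_toCircle hb e2))
  obtain ⟨c, hc2, hc⟩ : ∃ c < 2, ∀ z ∈ Uᶜ, F z ≤ c := by
    rcases Uᶜ.eq_empty_or_nonempty with h | h
    · exact ⟨0, by norm_num, by simp [h]⟩
    · obtain ⟨z, hz, hmax⟩ := hU.isClosed_compl.isCompact.exists_isMaxOn h hF.continuousOn
      exact ⟨F z, hlt z (fun e => hz (e ▸ hz₀)), hmax⟩
  -- The cut-off level lies strictly between `c` and 2: the closed support avoids `Uᶜ`, and the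
  -- value at `z₀` is positive.
  have hsm : IsSmooth fun z => expNegInvGlue (F z - (c + 2) / 2) :=
    isSmooth_comp_re_toCircle expNegInvGlue.contDiff _ z₀
  refine ⟨_, ⟨hsm, ?_⟩, ?_⟩
  · have hsub : tsupport (fun z => expNegInvGlue (F z - (c + 2) / 2)) ⊆ {z | (c + 2) / 2 ≤ F z} := by
      refine closure_minimal (fun z hz => ?_) (isClosed_le continuous_const hF)
      by_contra hlt'
      refine hz (expNegInvGlue.zero_of_nonpos ?_)
      rw [Set.mem_ofPred_eq, not_le] at hlt'
      linarith
    intro z hz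
    by_contra hzU
    have h1 := hsub hz
    have h2 := hc z hzU
    rw [Set.mem_ofPred_eq] at h1
    linarith
  · refine (hsm.continuous.pow 2).integral_pos_of_hasCompactSupport_nonneg_nonzero
      (HasCompactSupport.of_compactSpace _) (fun z => sq_nonneg _) (x := z₀) ?_
    have : 0 < expNegInvGlue (F z₀ - (c + 2) / 2) :=
      expNegInvGlue.pos_of_pos (by rw [hF₀]; linarith)
    exact (pow_pos this 2).ne'

end Bumps

-- The double covering and its deck transformation.

section Covering

variable {b : ℝ}

theorem cover_torusMk (p : ℝ × ℝ) : cover b (torusMk 2 b p) = torusMk 1 b p := rfl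

theorem sigma_torusMk (x y : ℝ) : sigma b (torusMk 2 b (x, y)) = torusMk 2 b (x + 1, y) := rfl

theorem continuous_cover : Continuous (cover b) := by
  refine (isOpenQuotientMap_torusMk (a := 2) (b := b)).isQuotientMap.continuous_iff.2 ?_
  exact continuous_torusMk (a := 1) (b := b)

theorem isQuotientMap_cover : Topology.IsQuotientMap (cover b) :=
  Topology.IsQuotientMap.of_comp (continuous_torusMk (a := 2)) continuous_cover
    (isOpenQuotientMap_torusMk (a := 1) (b := b)).isQuotientMap

theorem continuous_sigma : Continuous (sigma b) := by
  unfold sigma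
  fun_prop

theorem sigma_sigma (z : Torus 2 b) : sigma b (sigma b z) = z := by
  obtain ⟨⟨x, y⟩, rfl⟩ := torusMk_surjective z
  rw [sigma_torusMk, sigma_torusMk, add_assoc, one_add_one_eq_two]
  exact Prod.ext (AddCircle.coe_add_period 2 x) rfl

theorem cover_sigma (z : Torus 2 b) : cover b (sigma b z) = cover b z := by
  obtain ⟨⟨x, y⟩, rfl⟩ := torusMk_surjective z
  rw [sigma_torusMk, cover_torusMk, cover_torusMk]
  exact Prod.ext (AddCircle.coe_add_period 1 x) rfl

theorem eq_or_eq_sigma_of_cover_eq {z w : Torus 2 b} (h : cover b w = cover b z) :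
    w = z ∨ w = sigma b z := by
  obtain ⟨⟨x, y⟩, rfl⟩ := torusMk_surjective z
  obtain ⟨⟨x', y'⟩, rfl⟩ := torusMk_surjective w
  rw [cover_torusMk, cover_torusMk] at h
  have hy : (y' : AddCircle b) = y := congrArg Prod.snd h
  have hx : ((x' - x : ℝ) : AddCircle (1 : ℝ)) = 0 := by
    rw [AddCircle.coe_sub, sub_eq_zero]
    exact congrArg Prod.fst h
  obtain ⟨n, hn⟩ := (AddCircle.coe_eq_zero_iff 1).1 hx
  rw [zsmul_one] at hn
  rcases Int.even_or_odd' n with ⟨m, rfl | rfl⟩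
  · left
    refine Prod.ext ?_ hy
    have : ((x' - x : ℝ) : AddCircle (2 : ℝ)) = 0 :=
      (AddCircle.coe_eq_zero_iff 2).2 ⟨m, by rw [← hn, zsmul_eq_mul]; push_cast; ring⟩
    rwa [AddCircle.coe_sub, sub_eq_zero] at this
  · right
    refine Prod.ext ?_ hy
    have : ((x' - (x + 1) : ℝ) : AddCircle (2 : ℝ)) = 0 :=
      (AddCircle.coe_eq_zero_iff 2).2 ⟨m, by
        rw [← sub_sub, ← hn, zsmul_eq_mul]; push_cast; ring⟩
    rwa [AddCircle.coe_sub, sub_eq_zero] at this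

/-- The deck transformation, as a homeomorphism. -/
def sigmaHomeomorph (b : ℝ) : Torus 2 b ≃ₜ Torus 2 b where
  toFun := sigma b
  invFun := sigma b
  left_inv := sigma_sigma
  right_inv := sigma_sigma
  continuous_toFun := continuous_sigma
  continuous_invFun := continuous_sigma

/-- Both functions have the same lift to the plane, definitionally. -/
theorem IsSmooth.comp_cover {φ : Torus 1 b → ℝ} (h : IsSmooth φ) : IsSmooth (φ ∘ cover b) := h

theorem IsSmooth.comp_sigma {φ : Torus 2 b → ℝ} (h : IsSmooth φ) : IsSmooth (φ ∘ sigma b) := by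
  have h2 : ContDiff ℝ ((⊤ : ℕ∞) : WithTop ℕ∞) fun p : ℝ × ℝ => (p.1 + 1, p.2) := by fun_prop
  exact (isSmooth_iff.1 h).comp h2

theorem gradSq_comp_cover {φ : Torus 1 b → ℝ} (h : IsSmooth φ) :
    gradSq (φ ∘ cover b) = gradSq φ ∘ cover b := by
  funext z
  obtain ⟨⟨x, y⟩, rfl⟩ := torusMk_surjective z
  have h1 := (h.comp_cover.hasDerivAt_fst x y).unique (h.hasDerivAt_fst x y)
  have h2 := (h.comp_cover.hasDerivAt_snd x y).unique (h.hasDerivAt_snd x y)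
  simp only [gradSq, Function.comp_apply, h1, h2, cover_torusMk]

theorem dx_comp_sigma {φ : Torus 2 b → ℝ} (h : IsSmooth φ) (z : Torus 2 b) :
    dx (φ ∘ sigma b) z = dx φ (sigma b z) := by
  obtain ⟨⟨x, y⟩, rfl⟩ := torusMk_surjective z
  exact (h.comp_sigma.hasDerivAt_fst x y).unique
    ((h.hasDerivAt_fst (x + 1) y).comp_add_const x 1)

theorem dy_comp_sigma {φ : Torus 2 b → ℝ} (h : IsSmooth φ) (z : Torus 2 b) :
    dy (φ ∘ sigma b) z = dy φ (sigma b z) := by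
  obtain ⟨⟨x, y⟩, rfl⟩ := torusMk_surjective z
  exact (h.comp_sigma.hasDerivAt_snd x y).unique (h.hasDerivAt_snd (x + 1) y)

variable [Fact (0 < b)]

theorem integral_comp_sigma (f : Torus 2 b → ℝ) : ∫ z, f (sigma b z) = ∫ z, f z := by
  have h : MeasurePreserving (sigma b) volume volume :=
    (measurePreserving_add_right (volume : Measure (AddCircle (2 : ℝ)))
      ((1 : ℝ) : AddCircle (2 : ℝ))).prod (MeasurePreserving.id volume)
  exact h.integral_comp (sigmaHomeomorph b).measurableEmbedding f

/-- A continuous surjective homomorphism of compact groups carries normalised Haar measure to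
normalised Haar measure; the factor 2 in `integral_comp_cover` is the ratio of areas. -/
theorem measurePreserving_cover :
    MeasurePreserving (cover b) (torusHaar 2 b) (torusHaar 1 b) := by
  have hc : Continuous mod1 :=
    (QuotientAddGroup.isOpenQuotientMap_mk (G := ℝ)
      (N := AddSubgroup.zmultiples (2 : ℝ))).isQuotientMap.continuous_iff.2
      (AddCircle.continuous_mk' 1)
  have hs : Function.Surjective mod1 := fun y => by
    obtain ⟨x, rfl⟩ := QuotientAddGroup.mk_surjective y
    exact ⟨(x : AddCircle (2 : ℝ)), rfl⟩
  have h : MeasurePreserving mod1 (AddCircle.haarAddCircle (T := 2))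
      (AddCircle.haarAddCircle (T := 1)) :=
    AddMonoidHom.measurePreserving hc hs (by rw [measure_univ, measure_univ])
  exact h.prod (MeasurePreserving.id _)

theorem integral_comp_cover {f : Torus 1 b → ℝ} (hf : Continuous f) :
    ∫ z, f (cover b z) = 2 * ∫ z, f z := by
  rw [integral_volume_eq_torusHaar, integral_volume_eq_torusHaar (a := 1),
    ← measurePreserving_cover.map_eq,
    integral_map continuous_cover.measurable.aemeasurable hf.aestronglyMeasurable]
  simp only [smul_eq_mul]
  ring

end Covering

-- Components of the preimage of a domain.

section Sheets

variable {b : ℝ}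

/-- An open set `C` is a sheet over `U` if the preimage of `U` under the covering is the disjoint
union of `C` and of its image under the deck transformation. -/
structure IsSheet (U : Set (Torus 1 b)) (C : Set (Torus 2 b)) : Prop where
  isOpen : IsOpen C
  disjoint : Disjoint C (sigma b ⁻¹' C)
  preimage_eq : cover b ⁻¹' U = C ∪ sigma b ⁻¹' C

theorem sigma_preimage_cover_preimage (U : Set (Torus 1 b)) :
    sigma b ⁻¹' (cover b ⁻¹' U) = cover b ⁻¹' U := by
  ext z
  simp only [Set.mem_preimage, cover_sigma]

theorem sigma_preimage_sigma_preimage (A : Set (Torus 2 b)) :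
    sigma b ⁻¹' (sigma b ⁻¹' A) = A := by
  ext z
  simp only [Set.mem_preimage, sigma_sigma]

theorem sigma_image_eq_preimage (A : Set (Torus 2 b)) : sigma b '' A = sigma b ⁻¹' A :=
  (sigmaHomeomorph b).toEquiv.image_eq_preimage_symm A

theorem cover_preimage_image {A : Set (Torus 2 b)} (hA : sigma b ⁻¹' A = A) :
    cover b ⁻¹' (cover b '' A) = A := by
  refine Set.Subset.antisymm ?_ (Set.subset_preimage_image _ _)
  rintro z ⟨w, hw, h⟩
  rcases eq_or_eq_sigma_of_cover_eq h.symm with rfl | rfl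
  · exact hw
  · rw [← hA] at hw
    exact hw

theorem sigma_preimage_connectedComponentIn {U : Set (Torus 1 b)} {z : Torus 2 b}
    (hz : z ∈ cover b ⁻¹' U) :
    sigma b ⁻¹' connectedComponentIn (cover b ⁻¹' U) z
      = connectedComponentIn (cover b ⁻¹' U) (sigma b z) := by
  rw [← sigma_image_eq_preimage]
  have := (sigmaHomeomorph b).image_connectedComponentIn hz
  change sigma b '' _ = connectedComponentIn (sigma b '' _) (sigma b z) at this
  rw [this, sigma_image_eq_preimage, sigma_preimage_cover_preimage]

/-- The union `A` and its complement in the preimage are open and `sigma`-invariant, so their images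
are open, disjoint and cover `U`; connectedness of `U` leaves no room for the second. -/
theorem cover_preimage_eq_union {U : Set (Torus 1 b)} (hU : IsPreconnected U)
    (hopen : ∀ z ∈ cover b ⁻¹' U, IsOpen (connectedComponentIn (cover b ⁻¹' U) z))
    {z : Torus 2 b} (hz : z ∈ cover b ⁻¹' U) :
    cover b ⁻¹' U = connectedComponentIn (cover b ⁻¹' U) z
      ∪ sigma b ⁻¹' connectedComponentIn (cover b ⁻¹' U) z := by
  have hσz : sigma b z ∈ cover b ⁻¹' U := by rwa [Set.mem_preimage, cover_sigma]
  set P := cover b ⁻¹' U with hP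
  set A := connectedComponentIn P z ∪ sigma b ⁻¹' connectedComponentIn P z with hA
  have hAP : A ⊆ P := by
    refine Set.union_subset (connectedComponentIn_subset _ _) ?_
    rw [hP, sigma_preimage_connectedComponentIn hz]
    exact connectedComponentIn_subset _ _
  have hAo : IsOpen A := by
    refine (hopen z hz).union ?_
    rw [hP, sigma_preimage_connectedComponentIn hz]
    exact hopen _ hσz
  have hAσ : sigma b ⁻¹' A = A := by
    rw [hA, Set.preimage_union, sigma_preimage_sigma_preimage, Set.union_comm]
  have hBσ : sigma b ⁻¹' (P \ A) = P \ A := by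
    rw [Set.preimage_sdiff, hAσ, hP, sigma_preimage_cover_preimage]
  have hBo : IsOpen (P \ A) := by
    rw [isOpen_iff_forall_mem_open]
    rintro w ⟨hwP, hwA⟩
    refine ⟨connectedComponentIn P w, fun v hv => ⟨connectedComponentIn_subset _ _ hv, fun hvA =>
      hwA ?_⟩, hopen w hwP, mem_connectedComponentIn hwP⟩
    have hwv : w ∈ connectedComponentIn P v := by
      rw [← connectedComponentIn_eq hv]; exact mem_connectedComponentIn hwP
    rcases hvA with hvA | hvA
    · left
      rwa [connectedComponentIn_eq hvA]
    · right
      rw [hP, sigma_preimage_connectedComponentIn hz] at hvA ⊢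
      rwa [connectedComponentIn_eq hvA]
  refine Set.Subset.antisymm (fun w hw => ?_) hAP
  by_contra hwA
  have hAi : IsOpen (cover b '' A) := by
    rw [← isQuotientMap_cover.isOpen_preimage, cover_preimage_image hAσ]; exact hAo
  have hBi : IsOpen (cover b '' (P \ A)) := by
    rw [← isQuotientMap_cover.isOpen_preimage, cover_preimage_image hBσ]; exact hBo
  obtain ⟨v, -, ⟨v₁, hv₁, rfl⟩, hv₂⟩ := hU _ _ hAi hBi
    (fun u hu => by
      obtain ⟨v, rfl⟩ := isQuotientMap_cover.surjective u
      by_cases hv : v ∈ A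
      · exact Or.inl ⟨v, hv, rfl⟩
      · exact Or.inr ⟨v, ⟨hu, hv⟩, rfl⟩)
    ⟨cover b z, hz, z, Or.inl (mem_connectedComponentIn hz), rfl⟩
    ⟨cover b w, hw, w, ⟨hw, hwA⟩, rfl⟩
  have : v₁ ∈ cover b ⁻¹' (cover b '' (P \ A)) := hv₂
  rw [cover_preimage_image hBσ] at this
  exact this.2 hv₁

/-- When the number of the lifted domains is twice the number of the domains, the lifted domains
are sheets. -/
theorem isSheet_of_range_eq_liftedDomains {k : ℕ} {D : Fin k → Set (Torus 1 b)}
    (hD : IsPartition D) {E : Fin (2 * k) → Set (Torus 2 b)} (hE : IsPartition E)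
    (hlift : Set.range E = liftedDomains b D) :
    (∀ j, ∃ i, IsSheet (D i) (E j)) ∧ ∀ i, ∃ j, IsSheet (D i) (E j) := by
  classical
  have hEinj : Function.Injective E := by
    intro i j hij
    by_contra hne
    have := hE.disjoint i j hne
    rw [hij, disjoint_self] at this
    exact (hE.isConnected j).nonempty.ne_empty this
  have hcomp : ∀ i, ∀ z ∈ cover b ⁻¹' D i,
      ∃ j, E j = connectedComponentIn (cover b ⁻¹' D i) z := fun i z hz => by
    have : connectedComponentIn (cover b ⁻¹' D i) z ∈ Set.range E := by
      rw [hlift]; exact ⟨i, z, hz, rfl⟩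
    exact this
  have hopen : ∀ i, ∀ z ∈ cover b ⁻¹' D i,
      IsOpen (connectedComponentIn (cover b ⁻¹' D i) z) := fun i z hz => by
    obtain ⟨j, hj⟩ := hcomp i z hz
    rw [← hj]; exact hE.isOpen j
  have hne : ∀ i, ∃ z, z ∈ cover b ⁻¹' D i := fun i => by
    obtain ⟨u, hu⟩ := (hD.isConnected i).nonempty
    obtain ⟨z, rfl⟩ := isQuotientMap_cover.surjective u
    exact ⟨z, hu⟩
  choose z hz using hne
  have hσz : ∀ i, sigma b (z i) ∈ cover b ⁻¹' D i := fun i => by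
    rw [Set.mem_preimage, cover_sigma]; exact hz i
  -- All possible components, `2 * k` of them with repetitions. The `2 * k` distinct sets `E j` are
  -- among them, so `F` is injective and the two candidates over each `D i` differ.
  let F : Fin k × Bool → Set (Torus 2 b) := fun p =>
    if p.2 then connectedComponentIn (cover b ⁻¹' D p.1) (z p.1)
    else sigma b ⁻¹' connectedComponentIn (cover b ⁻¹' D p.1) (z p.1)
  have hF : ∀ i, ∀ w ∈ cover b ⁻¹' D i, ∃ s, connectedComponentIn (cover b ⁻¹' D i) w = F (i, s) := by
    intro i w hw
    have hw' := hw
    rw [cover_preimage_eq_union (hD.isConnected i).isPreconnected (hopen i) (hz i)] at hw'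
    rcases hw' with h | h
    · exact ⟨true, (connectedComponentIn_eq h).symm⟩
    · refine ⟨false, ?_⟩
      simp only [F]
      rw [sigma_preimage_connectedComponentIn (hz i)] at h ⊢
      exact (connectedComponentIn_eq h).symm
  have hinj : Function.Injective F := by
    have hsub : Finset.univ.image E ⊆ Finset.univ.image F := by
      intro A hA
      obtain ⟨j, -, rfl⟩ := Finset.mem_image.1 hA
      obtain ⟨i, w, hw, h⟩ : E j ∈ liftedDomains b D := hlift ▸ Set.mem_range_self j
      obtain ⟨s, hs⟩ := hF i w hw
      rw [h, hs]
      exact Finset.mem_image_of_mem F (Finset.mem_univ _)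
    have hcard := Finset.card_le_card hsub
    rw [Finset.card_image_of_injective _ hEinj] at hcard
    rw [← Set.injOn_univ, ← Finset.coe_univ, ← Finset.card_image_iff]
    refine le_antisymm Finset.card_image_le ?_
    simp only [Finset.card_univ, Fintype.card_fin, Fintype.card_prod, Fintype.card_bool] at hcard ⊢
    omega
  have hsheet : ∀ i, IsSheet (D i) (connectedComponentIn (cover b ⁻¹' D i) (z i)) := fun i => by
    refine ⟨hopen i _ (hz i), ?_,
      cover_preimage_eq_union (hD.isConnected i).isPreconnected (hopen i) (hz i)⟩
    have hFne : F (i, true) ≠ F (i, false) := fun h => by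
      have := hinj h
      simp at this
    obtain ⟨j₁, h₁⟩ := hcomp i _ (hz i)
    obtain ⟨j₂, h₂⟩ := hcomp i _ (hσz i)
    have e₁ : F (i, true) = E j₁ := h₁.symm
    have e₂ : F (i, false) = E j₂ := by
      rw [h₂, ← sigma_preimage_connectedComponentIn (hz i)]; rfl
    have hj : j₁ ≠ j₂ := fun h => hFne (by rw [e₁, e₂, h])
    rw [← h₁, show sigma b ⁻¹' E j₁ = E j₂ by
      rw [h₁, h₂, sigma_preimage_connectedComponentIn (hz i)]]
    exact hE.disjoint j₁ j₂ hj
  refine ⟨fun j => ?_, fun i => ?_⟩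
  · obtain ⟨i, w, hw, h⟩ : E j ∈ liftedDomains b D := hlift ▸ Set.mem_range_self j
    refine ⟨i, ?_⟩
    obtain ⟨s, hs⟩ := hF i w hw
    rw [h, hs]
    -- Being a sheet is symmetric under exchanging `C` with its translate.
    cases s
    · obtain ⟨h1, h2, h3⟩ := hsheet i
      refine ⟨h1.preimage continuous_sigma, ?_, ?_⟩
      · change Disjoint (sigma b ⁻¹' _) (sigma b ⁻¹' (sigma b ⁻¹' _))
        rw [sigma_preimage_sigma_preimage]
        exact h2.symm
      · change _ = (sigma b ⁻¹' _) ∪ (sigma b ⁻¹' (sigma b ⁻¹' _))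
        rw [sigma_preimage_sigma_preimage, Set.union_comm]
        exact h3
    · exact hsheet i
  · obtain ⟨j, hj⟩ := hcomp i _ (hz i)
    exact ⟨j, hj ▸ hsheet i⟩

end Sheets

-- Moving test functions between a domain and its sheets.

section Transfer

variable {b : ℝ}

/-- Cutting at the boundary of `C` loses no smoothness: the support of the lift stays inside the
disjoint open sets `C` and `sigma b ⁻¹' C`, so the part in `C` has closed support in `C`. -/
theorem indicator_mem_testFunctions {U : Set (Torus 1 b)} {C : Set (Torus 2 b)}
    (hC : IsSheet U C) {φ : Torus 1 b → ℝ} (hφ : φ ∈ testFunctions U) :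
    C.indicator (φ ∘ cover b) ∈ testFunctions C := by
  have hsupp : tsupport (φ ∘ cover b) ⊆ C ∪ sigma b ⁻¹' C := by
    rw [← hC.preimage_eq]
    exact (tsupport_comp_subset_preimage φ continuous_cover).trans (Set.preimage_mono hφ.2)
  have hC' : IsOpen (sigma b ⁻¹' C) := hC.isOpen.preimage continuous_sigma
  have hsub : tsupport (C.indicator (φ ∘ cover b)) ⊆ C := by
    have h1 : tsupport (C.indicator (φ ∘ cover b))
        ⊆ tsupport (φ ∘ cover b) ∩ (sigma b ⁻¹' C)ᶜ := by
      refine closure_minimal (fun z hz => ?_) ((isClosed_tsupport _).inter hC'.isClosed_compl)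
      have hz' := Set.mem_of_indicator_ne_zero hz
      refine ⟨subset_tsupport _ ?_, fun h => Set.disjoint_left.1 hC.disjoint hz' h⟩
      rw [Function.mem_support, Set.indicator_of_mem hz'] at hz
      exact hz
    intro z hz
    exact (hsupp (h1 hz).1).resolve_right (h1 hz).2
  refine ⟨isSmooth_of_forall_eventuallyEq fun z => ?_, hsub⟩
  by_cases hz : z ∈ C
  · refine ⟨φ ∘ cover b, hφ.1.comp_cover, ?_⟩
    filter_upwards [hC.isOpen.mem_nhds hz] with w hw
    exact Set.indicator_of_mem hw _
  · refine ⟨0, isSmooth_zero, ?_⟩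
    exact notMem_tsupport_iff_eventuallyEq.1 fun h => hz (hsub h)

theorem indicator_add_comp_sigma {U : Set (Torus 1 b)} {C : Set (Torus 2 b)}
    (hC : IsSheet U C) {φ : Torus 1 b → ℝ} (hφ : φ ∈ testFunctions U) :
    C.indicator (φ ∘ cover b) + C.indicator (φ ∘ cover b) ∘ sigma b = φ ∘ cover b := by
  funext z
  by_cases hz : z ∈ C
  · have hz' : sigma b z ∉ C := Set.disjoint_left.1 hC.disjoint hz
    simp [hz, hz']
  · by_cases hz' : sigma b z ∈ C
    · simp [hz, hz', cover_sigma]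
    · have : cover b z ∉ U := fun h => by
        have : z ∈ cover b ⁻¹' U := h
        rw [hC.preimage_eq] at this
        exact this.elim hz hz'
      have h0 : φ (cover b z) = 0 :=
        image_eq_zero_of_notMem_tsupport fun h => this (hφ.2 h)
      simp [hz, hz', h0]

theorem notMem_tsupport_or_sigma {C : Set (Torus 2 b)} (hC : Disjoint C (sigma b ⁻¹' C))
    {ψ : Torus 2 b → ℝ} (hψ : ψ ∈ testFunctions C) (z : Torus 2 b) :
    z ∉ tsupport ψ ∨ sigma b z ∉ tsupport ψ := by
  rw [← not_and_or]
  exact fun h => Set.disjoint_left.1 hC (hψ.2 h.1) (hψ.2 h.2)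

theorem dx_add_smul_comp_sigma {ψ : Torus 2 b → ℝ} (hψ : IsSmooth ψ) (s : ℝ) (z : Torus 2 b) :
    dx (ψ + s • (ψ ∘ sigma b)) z = dx ψ z + s * dx ψ (sigma b z) := by
  rw [dx_add hψ (hψ.comp_sigma.smul s), dx_smul s hψ.comp_sigma]
  simp only [Pi.add_apply, Pi.smul_apply, smul_eq_mul, dx_comp_sigma hψ]

theorem dy_add_smul_comp_sigma {ψ : Torus 2 b → ℝ} (hψ : IsSmooth ψ) (s : ℝ) (z : Torus 2 b) :
    dy (ψ + s • (ψ ∘ sigma b)) z = dy ψ z + s * dy ψ (sigma b z) := by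
  rw [dy_add hψ (hψ.comp_sigma.smul s), dy_smul s hψ.comp_sigma]
  simp only [Pi.add_apply, Pi.smul_apply, smul_eq_mul, dy_comp_sigma hψ]

variable [Fact (0 < b)]

theorem integral_add_comp_sigma {f : Torus 2 b → ℝ} (hf : Continuous f) :
    ∫ z, (f z + f (sigma b z)) = 2 * ∫ z, f z := by
  have h := integral_add (integrable_of_continuous_real hf)
    (integrable_of_continuous_real (hf.comp continuous_sigma))
  simp only [Function.comp_apply, integral_comp_sigma] at h
  rw [h]
  ring

/-- The two terms have disjoint supports, so cross terms vanish and only `s ^ 2` matters: `s = 1`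
serves for descent to the base, `s = -1` for antisymmetrisation. -/
theorem integral_sq_add_smul_comp_sigma {C : Set (Torus 2 b)} (hC : Disjoint C (sigma b ⁻¹' C))
    {ψ : Torus 2 b → ℝ} (hψ : ψ ∈ testFunctions C) {s : ℝ} (hs : s ^ 2 = 1) :
    ∫ z, (ψ + s • (ψ ∘ sigma b)) z ^ 2 = 2 * ∫ z, ψ z ^ 2 := by
  refine Eq.trans ?_ (integral_add_comp_sigma (hψ.1.continuous.pow 2))
  refine integral_congr_ae (.of_forall fun z => ?_)
  simp only [Pi.add_apply, Pi.smul_apply, smul_eq_mul, Function.comp_apply]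
  rcases notMem_tsupport_or_sigma hC hψ z with h | h
  · rw [image_eq_zero_of_notMem_tsupport h]
    linear_combination ψ (sigma b z) ^ 2 * hs
  · rw [image_eq_zero_of_notMem_tsupport h]
    ring

theorem integral_gradSq_add_smul_comp_sigma {C : Set (Torus 2 b)}
    (hC : Disjoint C (sigma b ⁻¹' C)) {ψ : Torus 2 b → ℝ} (hψ : ψ ∈ testFunctions C) {s : ℝ}
    (hs : s ^ 2 = 1) :
    ∫ z, gradSq (ψ + s • (ψ ∘ sigma b)) z = 2 * ∫ z, gradSq ψ z := by
  rw [← integral_add_comp_sigma hψ.1.continuous_gradSq]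
  refine integral_congr_ae (.of_forall fun z => ?_)
  simp only [gradSq, dx_add_smul_comp_sigma hψ.1, dy_add_smul_comp_sigma hψ.1]
  rcases notMem_tsupport_or_sigma hC hψ z with h | h
  · rw [dx_eq_zero_of_notMem_tsupport h, dy_eq_zero_of_notMem_tsupport h]
    linear_combination (dx ψ (sigma b z) ^ 2 + dy ψ (sigma b z) ^ 2) * hs
  · rw [dx_eq_zero_of_notMem_tsupport h, dy_eq_zero_of_notMem_tsupport h]
    ring

/-- Both integrals over the double cover are doubled, once by the two sheets and once by the
covering, and the factors cancel. -/
theorem integral_eq_of_comp_cover_eq {C : Set (Torus 2 b)} (hC : Disjoint C (sigma b ⁻¹' C))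
    {ψ : Torus 2 b → ℝ} (hψ : ψ ∈ testFunctions C) {φ : Torus 1 b → ℝ} (hφ : IsSmooth φ)
    (h : ψ + ψ ∘ sigma b = φ ∘ cover b) :
    ∫ z, ψ z ^ 2 = ∫ z, φ z ^ 2 ∧ ∫ z, gradSq ψ z = ∫ z, gradSq φ z := by
  have h1 := integral_sq_add_smul_comp_sigma hC hψ (s := 1) (by norm_num)
  have h2 := integral_gradSq_add_smul_comp_sigma hC hψ (s := 1) (by norm_num)
  rw [one_smul, h] at h1 h2
  rw [gradSq_comp_cover hφ] at h2
  have h3 := integral_comp_cover (hφ.continuous.pow 2)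
  have h4 := integral_comp_cover hφ.continuous_gradSq
  simp only [Function.comp_apply, Pi.pow_apply] at h1 h2 h3 h4
  constructor <;> linarith

theorem exists_testFunction_sheet {U : Set (Torus 1 b)} {C : Set (Torus 2 b)} (hC : IsSheet U C)
    {φ : Torus 1 b → ℝ} (hφ : φ ∈ testSubmodule U) :
    ∃ ψ ∈ testSubmodule C, ∫ z, ψ z ^ 2 = ∫ z, φ z ^ 2 ∧ ∫ z, gradSq ψ z = ∫ z, gradSq φ z :=
  ⟨_, indicator_mem_testFunctions hC hφ,
    integral_eq_of_comp_cover_eq hC.disjoint (indicator_mem_testFunctions hC hφ) hφ.1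
      (indicator_add_comp_sigma hC hφ)⟩

theorem exists_testFunction_base {U : Set (Torus 1 b)} {C : Set (Torus 2 b)} (hC : IsSheet U C)
    {ψ : Torus 2 b → ℝ} (hψ : ψ ∈ testSubmodule C) :
    ∃ φ ∈ testSubmodule U, ∫ z, φ z ^ 2 = ∫ z, ψ z ^ 2 ∧ ∫ z, gradSq φ z = ∫ z, gradSq ψ z := by
  have hψ' : ψ ∈ testFunctions C := hψ
  have hsec : ∀ u : Torus 1 b, cover b (Function.surjInv isQuotientMap_cover.surjective u) = u :=
    Function.surjInv_eq isQuotientMap_cover.surjective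
  -- The symmetrised function is `sigma`-invariant, so the chosen, possibly discontinuous, section
  -- plays no role.
  let φ : Torus 1 b → ℝ := fun u =>
    (ψ + ψ ∘ sigma b) (Function.surjInv isQuotientMap_cover.surjective u)
  have hcov : ψ + ψ ∘ sigma b = φ ∘ cover b := by
    funext z
    simp only [φ, Function.comp_apply, Pi.add_apply]
    rcases eq_or_eq_sigma_of_cover_eq (hsec (cover b z)) with h | h
    · rw [h]
    · rw [h, sigma_sigma, add_comm]
  have hφ : IsSmooth φ := by
    have : IsSmooth (φ ∘ cover b) := hcov ▸ hψ'.1.add hψ'.1.comp_sigma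
    exact this
  have hsupp : tsupport φ ⊆ U := by
    have hclosed : IsClosed (cover b '' tsupport ψ) :=
      ((isClosed_tsupport ψ).isCompact.image continuous_cover).isClosed
    have hsub : tsupport φ ⊆ cover b '' tsupport ψ := by
      refine closure_minimal (fun u hu => ?_) hclosed
      obtain ⟨z, rfl⟩ := isQuotientMap_cover.surjective u
      have hz : (ψ + ψ ∘ sigma b) z ≠ 0 := by rw [hcov]; exact hu
      by_cases h : ψ z = 0
      · refine ⟨sigma b z, subset_tsupport _ fun h' => hz ?_, cover_sigma z⟩
        simp [h, h']
      · exact ⟨z, subset_tsupport _ h, rfl⟩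
    refine hsub.trans ?_
    rintro _ ⟨z, hz, rfl⟩
    have : z ∈ cover b ⁻¹' U := hC.preimage_eq ▸ Or.inl (hψ'.2 hz)
    exact this
  obtain ⟨h1, h2⟩ := integral_eq_of_comp_cover_eq hC.disjoint hψ' hφ hcov
  exact ⟨φ, ⟨hφ, hsupp⟩, h1.symm, h2.symm⟩

/-- The smooth antisymmetric functions, as a linear space. -/
def antisymmetricSubmodule (b : ℝ) : Submodule ℝ (Torus 2 b → ℝ) where
  carrier := antisymmetricFunctions b
  zero_mem' := ⟨isSmooth_zero, fun z => by simp⟩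
  add_mem' := fun {φ ψ} hφ hψ => ⟨hφ.1.add hψ.1, fun z => by
    simp only [Pi.add_apply, hφ.2, hψ.2]; ring⟩
  smul_mem' := fun c φ hφ => ⟨hφ.1.smul c, fun z => by
    simp only [Pi.smul_apply, hφ.2, smul_neg]⟩

theorem exists_antisymmetric {U : Set (Torus 1 b)} {C : Set (Torus 2 b)} (hC : IsSheet U C)
    {φ : Torus 1 b → ℝ} (hφ : φ ∈ testSubmodule U) :
    ∃ ψ ∈ antisymmetricSubmodule b, tsupport ψ ⊆ cover b ⁻¹' U ∧
      ∫ z, ψ z ^ 2 = 2 * ∫ z, φ z ^ 2 ∧ ∫ z, gradSq ψ z = 2 * ∫ z, gradSq φ z := by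
  obtain ⟨ψ, hψ, h1, h2⟩ := exists_testFunction_sheet hC hφ
  have hψ' : ψ ∈ testFunctions C := hψ
  refine ⟨ψ + (-1 : ℝ) • (ψ ∘ sigma b), ⟨hψ'.1.add (hψ'.1.comp_sigma.smul _), fun z => ?_⟩, ?_, ?_, ?_⟩
  · simp only [Pi.add_apply, Pi.smul_apply, Function.comp_apply, sigma_sigma, smul_eq_mul]
    ring
  · refine (tsupport_add _ _).trans (Set.union_subset ?_ ?_)
    · rw [hC.preimage_eq]
      exact hψ'.2.trans Set.subset_union_left
    · rw [hC.preimage_eq]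
      refine (closure_mono (Function.support_const_smul_subset _ _)).trans ?_
      exact ((tsupport_comp_subset_preimage ψ continuous_sigma).trans
        (Set.preimage_mono hψ'.2)).trans Set.subset_union_right
  · rw [integral_sq_add_smul_comp_sigma hC.disjoint hψ' (by norm_num), h1]
  · rw [integral_gradSq_add_smul_comp_sigma hC.disjoint hψ' (by norm_num), h2]

end Transfer

-- Comparison of eigenvalues and energies.

section Energy

/-- Almost optimal functions of `C` have counterparts in `C'` with the same Rayleigh quotient. `hne`
excludes a default value of the right-hand side. -/
theorem eigenvalue_one_le_of_transfer {a b a' b' : ℝ} [Fact (0 < a)] [Fact (0 < b)] [Fact (0 < a')]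
    [Fact (0 < b')] {C : Submodule ℝ (Torus a b → ℝ)} {C' : Submodule ℝ (Torus a' b' → ℝ)}
    (hC : ∀ φ ∈ C, IsSmooth φ) (hC' : ∀ φ ∈ C', IsSmooth φ) (hne : ∃ φ ∈ C, 0 < ∫ z, φ z ^ 2)
    (h : ∀ φ ∈ C, ∃ ψ ∈ C', ∫ z, ψ z ^ 2 = ∫ z, φ z ^ 2 ∧ ∫ z, gradSq ψ z = ∫ z, gradSq φ z) :
    eigenvalue (C' : Set (Torus a' b' → ℝ)) 1 ≤ eigenvalue (C : Set (Torus a b → ℝ)) 1 := by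
  refine le_of_forall_gt_imp_ge_of_dense fun t ht => ?_
  obtain ⟨φ, hφ, hpos, hlt⟩ := exists_gradSq_lt hC hne ht
  obtain ⟨ψ, hψ, h1, h2⟩ := h φ hφ
  have := eigenvalue_one_mul_le hC' hψ (h1 ▸ hpos)
  rw [h1, h2] at this
  exact le_of_mul_le_mul_right (this.trans hlt.le) hpos

variable {b : ℝ} [Fact (0 < b)]

theorem dirichletEigenvalue_eq_of_isSheet {U : Set (Torus 1 b)} {C : Set (Torus 2 b)}
    (hC : IsSheet U C) (hU : IsOpen U) (hne : U.Nonempty) :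
    dirichletEigenvalue C 1 = dirichletEigenvalue U 1 := by
  have hU1 := exists_testFunction hU hne
  have hC1 : ∃ ψ ∈ testSubmodule C, 0 < ∫ z, ψ z ^ 2 := by
    obtain ⟨φ, hφ, hpos⟩ := hU1
    obtain ⟨ψ, hψ, h, -⟩ := exists_testFunction_sheet hC hφ
    exact ⟨ψ, hψ, h ▸ hpos⟩
  exact le_antisymm
    (eigenvalue_one_le_of_transfer (C := testSubmodule U) (C' := testSubmodule C)
      (fun φ hφ => hφ.1) (fun φ hφ => hφ.1) hU1 fun φ hφ => exists_testFunction_sheet hC hφ)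
    (eigenvalue_one_le_of_transfer (C := testSubmodule C) (C' := testSubmodule U)
      (fun φ hφ => hφ.1) (fun φ hφ => hφ.1) hC1 fun φ hφ => exists_testFunction_base hC hφ)

theorem antisymmetricEigenvalue_le_energy {k : ℕ} (hk : 1 ≤ k) {D : Fin k → Set (Torus 1 b)}
    (hD : IsPartition D) (hsheet : ∀ i, ∃ C, IsSheet (D i) C) :
    antisymmetricEigenvalue b k ≤ energy D := by
  refine le_of_forall_gt_imp_ge_of_dense fun t ht => ?_
  have hi : ∀ i, dirichletEigenvalue (D i) 1 < t := fun i =>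
    (le_ciSup (Set.finite_range fun i => dirichletEigenvalue (D i) 1).bddAbove i).trans_lt ht
  have hψ : ∀ i, ∃ ψ ∈ antisymmetricSubmodule b, tsupport ψ ⊆ cover b ⁻¹' D i ∧
      0 < ∫ z, ψ z ^ 2 ∧ ∫ z, gradSq ψ z ≤ t * ∫ z, ψ z ^ 2 := fun i => by
    obtain ⟨C, hC⟩ := hsheet i
    obtain ⟨φ, hφ, hpos, hlt⟩ := exists_gradSq_lt (C := testSubmodule (D i)) (fun φ hφ => hφ.1)
      (exists_testFunction (hD.isOpen i) (hD.isConnected i).nonempty) (hi i)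
    obtain ⟨ψ, hψ, hsupp, h1, h2⟩ := exists_antisymmetric hC hφ
    exact ⟨ψ, hψ, hsupp, by linarith, by rw [h1, h2]; linarith⟩
  choose ψ hψ hsupp hpos hle using hψ
  -- Preimages of disjoint domains are disjoint, which separates the supports although each `ψ i`
  -- charges both sheets.
  exact eigenvalue_le_of_disjoint (C := antisymmetricSubmodule b) (fun φ hφ => hφ.1) hk ψ hψ
    (fun i j hij => ((hD.disjoint i j hij).preimage (cover b)).mono (hsupp i) (hsupp j)) hpos hle

end Energy

end TorusPartition
end

theorem proposition2p6 (b : ℝ) [Fact (0 < b)] (k : ℕ) (hk : 1 ≤ k)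
    (D : Fin k → Set (TorusPartition.Torus 1 b)) (hD : TorusPartition.IsPartition D)
    (E : Fin (2 * k) → Set (TorusPartition.Torus 2 b)) (hE : TorusPartition.IsPartition E)
    (hlift : Set.range E = TorusPartition.liftedDomains b D) :
    TorusPartition.antisymmetricEigenvalue b k ≤ TorusPartition.energy E ∧
      TorusPartition.energy E = TorusPartition.energy D := by
  obtain ⟨hED, hDE⟩ := TorusPartition.isSheet_of_range_eq_liftedDomains hD hE hlift
  have henergy : TorusPartition.energy E = TorusPartition.energy D := by
    -- The two families have different index sets, so the suprema are compared through their sets of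
    -- values, which coincide.
    refine congrArg sSup (Set.Subset.antisymm ?_ ?_)
    · rintro _ ⟨j, rfl⟩
      obtain ⟨i, hi⟩ := hED j
      exact ⟨i, (TorusPartition.dirichletEigenvalue_eq_of_isSheet hi (hD.isOpen i)
        (hD.isConnected i).nonempty).symm⟩
    · rintro _ ⟨i, rfl⟩
      obtain ⟨j, hj⟩ := hDE i
      exact ⟨j, TorusPartition.dirichletEigenvalue_eq_of_isSheet hj (hD.isOpen i)
        (hD.isConnected i).nonempty⟩
  refine ⟨?_, henergy⟩
  rw [henergy]
  exact TorusPartition.antisymmetricEigenvalue_le_energy hk hD fun i =>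
    let ⟨j, hj⟩ := hDE i
    ⟨E j, hj⟩
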